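/- For a positive integer $n$ let $\Omega(n)$ denote the number of prime factors of $n$ counted with multiplicity (so $\Omega(1)=0$), and let $\lambda(n)=(-1)^{\Omega(n)}$ be the Liouville function. Then for every bounded function $f\colon\{0,1,2,\dots\}\to\mathbb{C}$, $$\lim_{N\to\infty}\left(\frac1N\sum_{n=1}^N f(\Omega(n)+1)-\frac1N\sum_{n=1}^N f(\Omega(n))\right)=0.$$ Moreover, the following special cases and consequences hold. (1) $\displaystyle\lim_{N\to\infty}\frac1N\sum_{n=1}^N\lambda(n)=0$. (2) For every integer $m\ge 1$ and every $\zeta\in\mathbb{C}$ with $\zeta^m=1$ and $\zeta\ne1$, $\displaystyle\lim_{N\to\infty}\frac1N\sum_{n=1}^N\zeta^{\Omega(n)}=0$. (3) (Pillai, Selberg) For every integer $m\ge1$ and every $r\in\{0,1,\dots,m-1\}$, the set $\{n\ge 1:\Omega(n)\equiv r \bmod m\}$ has asymptotic density $1/m$, that is, $\displaystyle\lim_{N\to\infty}\frac1N\,|\{1\le n\le N:\Omega(n)\equiv r \bmod m\}|=\frac1m$. (4) (Erdős, Delange) For every irrational real number $\alpha$, the sequence $(\Omega(n)\alpha)_{n\ge1}$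 is uniformly distributed mod $1$, that is, for all $0\le a<b\le1$, $\displaystyle\lim_{N\to\infty}\frac1N\,|\{1\le n\le N:\{\Omega(n)\alpha\}\in[a,b)\}|=b-a$, where $\{x\}$ denotes the fractional part of $x$. -/

import Mathlib

open scoped Classical in
/-- The set `A` of natural numbers has natural (asymptotic) density `d`:
`#{1 ≤ n ≤ N : n ∈ A} / N → d` as `N → ∞`. -/
def HasNaturalDensity (A : Set ℕ) (d : ℝ) : Prop :=
  Filter.Tendsto
    (fun N : ℕ => (((Finset.Icc 1 N).filter (fun n => n ∈ A)).card : ℝ) / (N : ℝ))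
    Filter.atTop (nhds d)

/-- The sequence `x 1, x 2, x 3, …` of real numbers is uniformly distributed mod 1: for every
interval `[a, b) ⊆ [0, 1)`, the indices `n` for which the fractional part of `x n` lies in
`[a, b)` have density `b - a`. -/
def UniformlyDistributedModOne (x : ℕ → ℝ) : Prop :=
  ∀ a b : ℝ, 0 ≤ a → a < b → b ≤ 1 →
    HasNaturalDensity {n : ℕ | Int.fract (x n) ∈ Set.Ico a b} (b - a)

/-!
Write `M a y` for the mean of `a` up to `y`. If `a (p * m) = a' m` for all primes `p`, the
Turán–Kubilius variance bound for the number of prime divisors from a finite set `P`, weighted by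
`b`, shows that `(∑ p ∈ P, b p) • M a y` is within `√(∑ p ∈ P, b p) + 1` of
`∑ p ∈ P, b p • M a' (y / p)` for large `y`. Since `ζ` has no zeros on the line `re z = 1`, sums of
`Λ(p) / p ^ (1 + σ + i t)` stay bounded away from `t = 0`, so by Plancherel averages over primes of
Lipschitz functions of `log p` are insensitive to a fixed shift of `log p`. Hence
`M a y - M a (y / l) → 0` for every fixed `l`, and a second use of the variance bound, with `a'`
now also slowly varying, gives `M a' y - M a y → 0`. Take `a n = f (Ω n)` and
`a' n = f (Ω n + 1)`. The remaining statements follow with `f k = z ^ k`, periodic `f`, and Weyl's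
criterion.
-/

section Mean

open Finset Filter MeasureTheory
open scoped NNReal

variable {E : Type*} [NormedAddCommGroup E]

lemma intervalIntegrable_comp_natCeil (a : ℕ → E) (x y : ℝ) :
    IntervalIntegrable (fun t : ℝ => a ⌈t⌉₊) volume x y := by
  have hmeas : StronglyMeasurable fun t : ℝ => a ⌈t⌉₊ :=
    (StronglyMeasurable.of_discrete (f := a)).comp_measurable Nat.measurable_ceil
  have hbound : ∀ t ∈ Set.uIoc x y, ‖a ⌈t⌉₊‖ ≤ ∑ k ∈ range (⌈max x y⌉₊ + 1), ‖a k‖ :=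
    fun t ht => single_le_sum (f := fun k => ‖a k‖) (fun _ _ => norm_nonneg _)
      (mem_range_succ_iff.2 (Nat.ceil_mono ht.2))
  refine (intervalIntegrable_const (c := ∑ k ∈ range (⌈max x y⌉₊ + 1), ‖a k‖)).mono_fun'
    hmeas.aestronglyMeasurable ?_
  filter_upwards [ae_restrict_mem measurableSet_uIoc] with t ht using hbound t ht

variable [NormedSpace ℝ E]

/-- The mean of `a 1, …, a N`. -/
noncomputable def cesaroMean (a : ℕ → E) (N : ℕ) : E :=
  (N : ℝ)⁻¹ • ∑ n ∈ Icc 1 N, a n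

/-- The extension of `cesaroMean a` to real arguments in which the sum is interpolated linearly
between consecutive integers, so that it becomes Lipschitz in `log y`. -/
noncomputable def interpolatedMean (a : ℕ → E) (y : ℝ) : E :=
  y⁻¹ • ∫ t in (0 : ℝ)..y, a ⌈t⌉₊

lemma norm_cesaroMean_le {a : ℕ → E} {C : ℝ} (ha : ∀ n, ‖a n‖ ≤ C) (N : ℕ) :
    ‖cesaroMean a N‖ ≤ C := by
  have hC : 0 ≤ C := (norm_nonneg _).trans (ha 0)
  have hsum : ‖∑ n ∈ Icc 1 N, a n‖ ≤ N * C := by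
    simpa using norm_sum_le_of_le (Icc 1 N) fun n _ => ha n
  rw [cesaroMean, norm_smul, norm_inv, Real.norm_natCast]
  exact inv_mul_le_of_le_mul₀ N.cast_nonneg hC hsum

lemma cesaroMean_const_smul {R : Type*} [DistribSMul R E] [SMulCommClass ℝ R E] (c : R)
    (a : ℕ → E) (N : ℕ) : cesaroMean (fun n => c • a n) N = c • cesaroMean a N := by
  rw [cesaroMean, cesaroMean, ← smul_sum, smul_comm]

lemma cesaroMean_eq_one_div_mul {𝕜 : Type*} [RCLike 𝕜] (a : ℕ → 𝕜) (N : ℕ) :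
    cesaroMean a N = 1 / (N : 𝕜) * ∑ n ∈ Icc 1 N, a n := by
  rw [cesaroMean, RCLike.real_smul_eq_coe_mul, RCLike.ofReal_inv, RCLike.ofReal_natCast, one_div]

lemma cesaroMean_congr {a b : ℕ → E} (hab : ∀ n, 0 < n → a n = b n) (N : ℕ) :
    cesaroMean a N = cesaroMean b N :=
  congrArg _ (sum_congr rfl fun n hn => hab n (mem_Icc.1 hn).1)

lemma cesaroMean_sum {ι : Type*} (s : Finset ι) (a : ι → ℕ → E) (N : ℕ) :
    cesaroMean (fun n => ∑ i ∈ s, a i n) N = ∑ i ∈ s, cesaroMean (a i) N := by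
  simp_rw [cesaroMean, sum_comm (t := s), smul_sum]

lemma cesaroMean_add (a b : ℕ → E) (N : ℕ) :
    cesaroMean (fun n => a n + b n) N = cesaroMean a N + cesaroMean b N := by
  simp_rw [cesaroMean, sum_add_distrib, smul_add]

lemma cesaroMean_sub (a b : ℕ → E) (N : ℕ) :
    cesaroMean (fun n => a n - b n) N = cesaroMean a N - cesaroMean b N := by
  simp_rw [cesaroMean, sum_sub_distrib, smul_sub]

lemma map_cesaroMean {F : Type*} [NormedAddCommGroup F] [NormedSpace ℝ F] (L : E →ₗ[ℝ] F)
    (a : ℕ → E) (N : ℕ) : L (cesaroMean a N) = cesaroMean (fun n => L (a n)) N := by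
  simp_rw [cesaroMean, map_smul, map_sum]

lemma cesaroMean_const (c : E) {N : ℕ} (hN : N ≠ 0) : cesaroMean (fun _ => c) N = c := by
  rw [cesaroMean, sum_const, Nat.card_Icc, Nat.add_sub_cancel, ← Nat.cast_smul_eq_nsmul ℝ,
    inv_smul_smul₀ (Nat.cast_ne_zero.2 hN)]

lemma cesaroMean_mono {a b : ℕ → ℝ} (hab : ∀ n, a n ≤ b n) (N : ℕ) :
    cesaroMean a N ≤ cesaroMean b N :=
  smul_le_smul_of_nonneg_left (sum_le_sum fun n _ => hab n) (by positivity)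

lemma integral_comp_natCeil_natCast [CompleteSpace E] (a : ℕ → E) (N : ℕ) :
    ∫ t in (0 : ℝ)..N, a ⌈t⌉₊ = ∑ n ∈ Icc 1 N, a n := by
  have hunit (k : ℕ) : ∫ t in (k : ℝ)..(k + 1 : ℕ), a ⌈t⌉₊ = a (k + 1) := by
    rw [intervalIntegral.integral_congr_uIoo (g := fun _ => a (k + 1))]
    · simp
    · intro t ht
      rw [Set.uIoo_of_le (by simp)] at ht
      exact congrArg a ((Nat.ceil_eq_iff k.succ_ne_zero).2 ⟨by simpa using ht.1, ht.2.le⟩)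
  have hsplit := intervalIntegral.sum_integral_adjacent_intervals (μ := volume)
    (f := fun t : ℝ => a ⌈t⌉₊) (a := fun k : ℕ => (k : ℝ)) (n := N)
    fun k _ => intervalIntegrable_comp_natCeil a _ _
  rw [Nat.cast_zero] at hsplit
  rw [← hsplit, sum_congr rfl fun k _ => hunit k, range_eq_Ico, sum_Ico_add' a 0 N 1,
    zero_add, Ico_add_one_right_eq_Icc]

lemma interpolatedMean_natCast [CompleteSpace E] (a : ℕ → E) (N : ℕ) :
    interpolatedMean a N = cesaroMean a N := by
  rw [interpolatedMean, cesaroMean, integral_comp_natCeil_natCast]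

lemma norm_integral_comp_natCeil_le {a : ℕ → E} {C : ℝ} (ha : ∀ n, ‖a n‖ ≤ C) (x y : ℝ) :
    ‖∫ t in x..y, a ⌈t⌉₊‖ ≤ C * |y - x| :=
  intervalIntegral.norm_integral_le_of_norm_le_const fun _ _ => ha _

lemma norm_interpolatedMean_le {a : ℕ → E} {C : ℝ} (ha : ∀ n, ‖a n‖ ≤ C) (y : ℝ) :
    ‖interpolatedMean a y‖ ≤ C := by
  have hC : 0 ≤ C := (norm_nonneg _).trans (ha 0)
  have hint : ‖∫ t in (0 : ℝ)..y, a ⌈t⌉₊‖ ≤ |y| * C := by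
    simpa [mul_comm] using norm_integral_comp_natCeil_le ha 0 y
  rw [interpolatedMean, norm_smul, norm_inv, Real.norm_eq_abs]
  exact inv_mul_le_of_le_mul₀ (abs_nonneg y) hC hint

lemma norm_integral_comp_natCeil_sub_sum_le [CompleteSpace E] {a : ℕ → E} {C : ℝ}
    (ha : ∀ n, ‖a n‖ ≤ C) {y : ℝ} (hy : 0 ≤ y) :
    ‖(∫ t in (0 : ℝ)..y, a ⌈t⌉₊) - ∑ n ∈ Icc 1 ⌊y⌋₊, a n‖ ≤ C := by
  have hC : 0 ≤ C := (norm_nonneg _).trans (ha 0)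
  have hfract : |y - ⌊y⌋₊| ≤ 1 := by
    rw [abs_of_nonneg (sub_nonneg.2 (Nat.floor_le hy))]
    linarith [Nat.lt_floor_add_one y]
  rw [← integral_comp_natCeil_natCast, intervalIntegral.integral_interval_sub_left
    (intervalIntegrable_comp_natCeil a _ _) (intervalIntegrable_comp_natCeil a _ _)]
  exact (norm_integral_comp_natCeil_le ha _ _).trans (mul_le_of_le_one_right hC hfract)

lemma norm_interpolatedMean_sub_le_log_sub {a : ℕ → E} {C : ℝ} (ha : ∀ n, ‖a n‖ ≤ C)
    {y z : ℝ} (hy : 0 < y) (hyz : y ≤ z) :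
    ‖interpolatedMean a y - interpolatedMean a z‖ ≤ 2 * C * (Real.log z - Real.log y) := by
  have hz : 0 < z := hy.trans_le hyz
  have hC : 0 ≤ C := (norm_nonneg _).trans (ha 0)
  have hsplit : interpolatedMean a y - interpolatedMean a z =
      (y⁻¹ - z⁻¹) • (∫ t in (0 : ℝ)..y, a ⌈t⌉₊) - z⁻¹ • ∫ t in y..z, a ⌈t⌉₊ := by
    rw [interpolatedMean, interpolatedMean, ← intervalIntegral.integral_add_adjacent_intervals
      (intervalIntegrable_comp_natCeil a 0 y) (intervalIntegrable_comp_natCeil a y z)]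
    module
  have hinv : 0 ≤ y⁻¹ - z⁻¹ := sub_nonneg.2 (inv_anti₀ hy hyz)
  have hhead : ‖∫ t in (0 : ℝ)..y, a ⌈t⌉₊‖ ≤ C * y := by
    simpa [abs_of_pos hy] using norm_integral_comp_natCeil_le ha 0 y
  have htail : ‖∫ t in y..z, a ⌈t⌉₊‖ ≤ C * (z - y) := by
    simpa [abs_of_nonneg (sub_nonneg.2 hyz)] using norm_integral_comp_natCeil_le ha y z
  have hlog : 1 - y / z ≤ Real.log z - Real.log y := by
    have := Real.one_sub_inv_le_log_of_pos (div_pos hz hy)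
    rwa [inv_div, Real.log_div hz.ne' hy.ne'] at this
  calc ‖interpolatedMean a y - interpolatedMean a z‖
      ≤ (y⁻¹ - z⁻¹) * (C * y) + z⁻¹ * (C * (z - y)) := by
        rw [hsplit]
        refine norm_sub_le_of_le ?_ ?_
        · rw [norm_smul, Real.norm_of_nonneg hinv]
          gcongr
        · rw [norm_smul, Real.norm_of_nonneg (inv_nonneg.2 hz.le)]
          gcongr
    _ = 2 * C * (1 - y / z) := by field_simp; ring
    _ ≤ 2 * C * (Real.log z - Real.log y) := by gcongr

lemma lipschitzWith_interpolatedMean_mul_exp_neg {a : ℕ → E} {C : ℝ≥0} (ha : ∀ n, ‖a n‖ ≤ C)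
    {y : ℝ} (hy : 0 < y) :
    LipschitzWith (2 * C) fun u : ℝ => interpolatedMean a (y * Real.exp (-u)) := by
  have hlog (u : ℝ) : Real.log (y * Real.exp (-u)) = Real.log y - u := by
    rw [Real.log_mul hy.ne' (Real.exp_ne_zero _), Real.log_exp, sub_eq_add_neg]
  refine LipschitzWith.of_dist_le_mul fun u v => ?_
  wlog huv : v ≤ u generalizing u v
  · simpa only [dist_comm] using this v u (le_of_not_ge huv)
  have hle : y * Real.exp (-u) ≤ y * Real.exp (-v) := by gcongr
  have := norm_interpolatedMean_sub_le_log_sub ha (by positivity) hle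
  rw [hlog, hlog, sub_sub_sub_cancel_left] at this
  rwa [dist_eq_norm, Real.dist_eq, abs_of_nonneg (sub_nonneg.2 huv)]

end Mean

section TuranKubilius

open Finset Filter Topology MeasureTheory

variable {P : Finset ℕ} {b : ℕ → ℝ}

/-- The additive function `n ↦ ∑_{p ∣ n} p b_p`, whose mean value is `∑ b_p`. -/
def divisorWeight (P : Finset ℕ) (b : ℕ → ℝ) (n : ℕ) : ℝ :=
  ∑ p ∈ P with p ∣ n, p * b p

lemma card_filter_dvd_Icc (p N : ℕ) : #{n ∈ Icc 1 N | p ∣ n} = N / p :=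
  Nat.Ioc_filter_dvd_card_eq_div N p

lemma sum_divisorWeight_smul {E : Type*} [AddCommGroup E] [Module ℝ E] (P : Finset ℕ) (b : ℕ → ℝ)
    (s : Finset ℕ) (a : ℕ → E) :
    ∑ n ∈ s, divisorWeight P b n • a n = ∑ p ∈ P, (p * b p) • ∑ n ∈ s with p ∣ n, a n := by
  simp_rw [divisorWeight, sum_smul, smul_sum, sum_filter]
  exact sum_comm

lemma sum_divisorWeight (P : Finset ℕ) (b : ℕ → ℝ) (s : Finset ℕ) :
    ∑ n ∈ s, divisorWeight P b n = ∑ p ∈ P, p * b p * #{n ∈ s | p ∣ n} := by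
  simpa using sum_divisorWeight_smul P b s (1 : ℕ → ℝ)

lemma le_sum_divisorWeight (hpos : ∀ p ∈ P, 0 < p) (hb0 : ∀ p ∈ P, 0 ≤ b p)
    (hb1 : ∀ p ∈ P, p * b p ≤ 1) (N : ℕ) :
    N * ∑ p ∈ P, b p - #P ≤ ∑ n ∈ Icc 1 N, divisorWeight P b n := by
  have hfloor (p : ℕ) (hp : p ∈ P) : (N : ℝ) ≤ p * (N / p : ℕ) + p := by
    exact_mod_cast (Nat.lt_mul_div_succ N (hpos p hp)).le
  have hterm (p : ℕ) (hp : p ∈ P) : N * b p - 1 ≤ p * b p * (N / p : ℕ) := by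
    linarith [mul_le_mul_of_nonneg_right (hfloor p hp) (hb0 p hp), hb1 p hp]
  calc N * ∑ p ∈ P, b p - #P = ∑ p ∈ P, (N * b p - 1) := by simp [mul_sum]
    _ ≤ ∑ p ∈ P, p * b p * (N / p : ℕ) := sum_le_sum hterm
    _ = ∑ n ∈ Icc 1 N, divisorWeight P b n := by
      simp_rw [sum_divisorWeight, card_filter_dvd_Icc]

lemma sum_divisorWeight_sq_le (hP : (P : Set ℕ).Pairwise Nat.Coprime) (hb0 : ∀ p ∈ P, 0 ≤ b p)
    (hb1 : ∀ p ∈ P, p * b p ≤ 1) (N : ℕ) :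
    ∑ n ∈ Icc 1 N, divisorWeight P b n ^ 2 ≤ N * (∑ p ∈ P, b p) ^ 2 + N * ∑ p ∈ P, b p := by
  have hexpand : ∑ n ∈ Icc 1 N, divisorWeight P b n ^ 2 =
      ∑ p ∈ P, ∑ q ∈ P, p * b p * (q * b q) * #{n ∈ Icc 1 N | p ∣ n ∧ q ∣ n} := by
    simp_rw [sq, ← smul_eq_mul (divisorWeight P b _), sum_divisorWeight_smul, sum_divisorWeight,
      smul_eq_mul, mul_sum, filter_filter, mul_assoc]
  have hbound (p : ℕ) (hp : p ∈ P) (q : ℕ) (hq : q ∈ P) :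
      p * b p * (q * b q) * #{n ∈ Icc 1 N | p ∣ n ∧ q ∣ n} ≤
        N * (b p * b q) + if p = q then N * b p else 0 := by
    have hbp := hb0 p hp
    have hbq := hb0 q hq
    have hdiv (d : ℕ) : (d : ℝ) * (N / d : ℕ) ≤ N := by exact_mod_cast Nat.mul_div_le N d
    by_cases hpq : p = q
    · subst hpq
      simp only [and_self, card_filter_dvd_Icc, if_true]
      calc p * b p * (p * b p) * (N / p : ℕ) = p * (N / p : ℕ) * b p * (p * b p) := by ring
        _ ≤ N * b p * 1 := by
          gcongr
          · exact hdiv p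
          · exact hb1 p hp
        _ ≤ N * (b p * b p) + N * b p := by
          rw [mul_one]
          exact le_add_of_nonneg_left (by positivity)
    · have hdvd (n : ℕ) : p ∣ n ∧ q ∣ n ↔ p * q ∣ n := by
        rw [← (hP hp hq hpq).lcm_eq_mul, Nat.lcm_dvd_iff]
      simp only [hdvd, card_filter_dvd_Icc, hpq, if_false, add_zero]
      calc p * b p * (q * b q) * (N / (p * q) : ℕ)
          = (p * q : ℕ) * (N / (p * q) : ℕ) * (b p * b q) := by push_cast; ring
        _ ≤ N * (b p * b q) := by gcongr; exact hdiv _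
  calc ∑ n ∈ Icc 1 N, divisorWeight P b n ^ 2
      ≤ ∑ p ∈ P, ∑ q ∈ P, (N * (b p * b q) + if p = q then N * b p else 0) := by
        rw [hexpand]
        exact sum_le_sum fun p hp => sum_le_sum fun q hq => hbound p hp q hq
    _ = N * (∑ p ∈ P, b p) ^ 2 + N * ∑ p ∈ P, b p := by
      simp_rw [sum_add_distrib, sq, sum_mul_sum, mul_sum]
      congr 1
      exact sum_congr rfl fun p hp => by simp [hp]

theorem sum_divisorWeight_sub_sq_le (hP : (P : Set ℕ).Pairwise Nat.Coprime)
    (hpos : ∀ p ∈ P, 0 < p) (hb0 : ∀ p ∈ P, 0 ≤ b p) (hb1 : ∀ p ∈ P, p * b p ≤ 1) (N : ℕ) :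
    ∑ n ∈ Icc 1 N, (divisorWeight P b n - ∑ p ∈ P, b p) ^ 2 ≤
      N * ∑ p ∈ P, b p + 2 * (∑ p ∈ P, b p) * #P := by
  set S := ∑ p ∈ P, b p
  have hS : 0 ≤ S := sum_nonneg hb0
  have hexpand : ∑ n ∈ Icc 1 N, (divisorWeight P b n - S) ^ 2 =
      ∑ n ∈ Icc 1 N, divisorWeight P b n ^ 2 - 2 * S * ∑ n ∈ Icc 1 N, divisorWeight P b n
        + N * S ^ 2 := by
    simp_rw [sub_sq, sum_add_distrib, sum_sub_distrib, mul_sum]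
    simp [mul_right_comm]
  have hfirst := mul_le_mul_of_nonneg_left (le_sum_divisorWeight hpos hb0 hb1 N)
    (by positivity : 0 ≤ 2 * S)
  have hsecond := sum_divisorWeight_sq_le hP hb0 hb1 N
  rw [hexpand]
  linarith

variable {E : Type*} [NormedAddCommGroup E] [NormedSpace ℝ E]

lemma norm_sum_divisorWeight_sub_smul_le (hP : (P : Set ℕ).Pairwise Nat.Coprime)
    (hpos : ∀ p ∈ P, 0 < p) (hb0 : ∀ p ∈ P, 0 ≤ b p) (hb1 : ∀ p ∈ P, p * b p ≤ 1)
    {a : ℕ → E} (ha : ∀ n, ‖a n‖ ≤ 1) (N : ℕ) :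
    ‖∑ n ∈ Icc 1 N, (divisorWeight P b n - ∑ p ∈ P, b p) • a n‖ ≤
      √(N * ∑ p ∈ P, b p + 2 * (∑ p ∈ P, b p) * #P) * √N := by
  set S := ∑ p ∈ P, b p
  calc ‖∑ n ∈ Icc 1 N, (divisorWeight P b n - S) • a n‖
      ≤ ∑ n ∈ Icc 1 N, |divisorWeight P b n - S| * 1 :=
        norm_sum_le_of_le _ fun n _ => by rw [norm_smul, Real.norm_eq_abs]; gcongr; exact ha n
    _ ≤ √(∑ n ∈ Icc 1 N, |divisorWeight P b n - S| ^ 2) * √(∑ _n ∈ Icc 1 N, (1 : ℝ) ^ 2) :=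
        Real.sum_mul_le_sqrt_mul_sqrt _ _ _
    _ ≤ √(N * S + 2 * S * #P) * √N := by
        simp only [sq_abs]
        gcongr
        · exact sum_divisorWeight_sub_sq_le hP hpos hb0 hb1 N
        · simp

end TuranKubilius

section DilationAverage

open Finset Filter Topology MeasureTheory

lemma sum_filter_dvd_Icc {M : Type*} [AddCommMonoid M] {p : ℕ} (hp : 0 < p) (a : ℕ → M) (N : ℕ) :
    ∑ n ∈ Icc 1 N with p ∣ n, a n = ∑ m ∈ Icc 1 (N / p), a (p * m) := by
  symm
  refine sum_bij (fun m _ => p * m) ?_ (fun _ _ _ _ h => Nat.eq_of_mul_eq_mul_left hp h) ?_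
    fun _ _ => rfl
  · intro m hm
    obtain ⟨hm1, hmN⟩ := mem_Icc.1 hm
    rw [mem_filter, mem_Icc]
    exact ⟨⟨Nat.mul_pos hp hm1, mul_comm p m ▸ (Nat.le_div_iff_mul_le hp).1 hmN⟩, dvd_mul_right p m⟩
  · intro n hn
    obtain ⟨hn, m, rfl⟩ := mem_filter.1 hn
    obtain ⟨hm1, hmN⟩ := mem_Icc.1 hn
    have hmN' : m ≤ N / p := (Nat.le_div_iff_mul_le hp).2 (mul_comm p m ▸ hmN)
    exact ⟨m, mem_Icc.2 ⟨Nat.pos_of_mul_pos_left hm1, hmN'⟩, rfl⟩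

variable {E : Type*} [NormedAddCommGroup E] [NormedSpace ℝ E]
  {P : Finset ℕ} {b : ℕ → ℝ} {a a' : ℕ → E}

lemma sum_divisorWeight_sub_smul (hpos : ∀ p ∈ P, 0 < p)
    (haa' : ∀ p ∈ P, ∀ m, 0 < m → a (p * m) = a' m) (S : ℝ) (N : ℕ) :
    ∑ n ∈ Icc 1 N, (divisorWeight P b n - S) • a n =
      ∑ p ∈ P, (p * b p) • ∑ m ∈ Icc 1 (N / p), a' m - S • ∑ n ∈ Icc 1 N, a n := by
  simp_rw [sub_smul, sum_sub_distrib, ← smul_sum, sum_divisorWeight_smul]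
  congr 1
  refine sum_congr rfl fun p hp => ?_
  rw [sum_filter_dvd_Icc (hpos p hp)]
  exact congrArg _ (sum_congr rfl fun m hm => haa' p hp m (mem_Icc.1 hm).1)

variable [CompleteSpace E]

lemma norm_sum_smul_integral_comp_natCeil_sub_le (hP : (P : Set ℕ).Pairwise Nat.Coprime)
    (hpos : ∀ p ∈ P, 0 < p) (hb0 : ∀ p ∈ P, 0 ≤ b p) (hb1 : ∀ p ∈ P, p * b p ≤ 1)
    (ha : ∀ n, ‖a n‖ ≤ 1) (ha' : ∀ n, ‖a' n‖ ≤ 1)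
    (haa' : ∀ p ∈ P, ∀ m, 0 < m → a (p * m) = a' m) {y : ℝ} (hy : 0 ≤ y) :
    ‖(∑ p ∈ P, b p) • (∫ t in (0 : ℝ)..y, a ⌈t⌉₊)
        - ∑ p ∈ P, (p * b p) • ∫ t in (0 : ℝ)..(y / p), a' ⌈t⌉₊‖ ≤
      ∑ p ∈ P, b p + #P + √(y * ∑ p ∈ P, b p + 2 * (∑ p ∈ P, b p) * #P) * √y := by
  set S := ∑ p ∈ P, b p
  have hS : 0 ≤ S := sum_nonneg hb0
  set N := ⌊y⌋₊ with hN
  have hNy : (N : ℝ) ≤ y := Nat.floor_le hy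
  have hround : ‖S • ((∫ t in (0 : ℝ)..y, a ⌈t⌉₊) - ∑ n ∈ Icc 1 N, a n)‖ ≤ S := by
    rw [norm_smul, Real.norm_of_nonneg hS]
    exact mul_le_of_le_one_right hS (norm_integral_comp_natCeil_sub_sum_le ha hy)
  have hround' : ‖∑ p ∈ P, (p * b p) • ((∫ t in (0 : ℝ)..(y / p), a' ⌈t⌉₊)
      - ∑ m ∈ Icc 1 (N / p), a' m)‖ ≤ #P := by
    rw [card_eq_sum_ones, Nat.cast_sum]
    refine norm_sum_le_of_le _ fun p hp => ?_
    rw [norm_smul, Real.norm_of_nonneg (mul_nonneg p.cast_nonneg (hb0 p hp)), Nat.cast_one, hN,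
      ← Nat.floor_div_natCast]
    exact mul_le_one₀ (hb1 p hp) (norm_nonneg _)
      (norm_integral_comp_natCeil_sub_sum_le ha' (by positivity))
  have hvariance : ‖∑ n ∈ Icc 1 N, (divisorWeight P b n - S) • a n‖ ≤
      √(y * S + 2 * S * #P) * √y :=
    (norm_sum_divisorWeight_sub_smul_le hP hpos hb0 hb1 ha N).trans (by gcongr)
  have hsplit : S • (∫ t in (0 : ℝ)..y, a ⌈t⌉₊)
        - ∑ p ∈ P, (p * b p) • ∫ t in (0 : ℝ)..(y / p), a' ⌈t⌉₊ =
      S • ((∫ t in (0 : ℝ)..y, a ⌈t⌉₊) - ∑ n ∈ Icc 1 N, a n)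
        - ∑ p ∈ P, (p * b p) • ((∫ t in (0 : ℝ)..(y / p), a' ⌈t⌉₊) - ∑ m ∈ Icc 1 (N / p), a' m)
        - ∑ n ∈ Icc 1 N, (divisorWeight P b n - S) • a n := by
    simp_rw [sum_divisorWeight_sub_smul hpos haa', smul_sub, sum_sub_distrib]
    abel
  rw [hsplit]
  exact norm_sub_le_of_le (norm_sub_le_of_le hround hround') hvariance

lemma norm_sum_smul_interpolatedMean_sub_le (hP : (P : Set ℕ).Pairwise Nat.Coprime)
    (hpos : ∀ p ∈ P, 0 < p) (hb0 : ∀ p ∈ P, 0 ≤ b p) (hb1 : ∀ p ∈ P, p * b p ≤ 1)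
    (ha : ∀ n, ‖a n‖ ≤ 1) (ha' : ∀ n, ‖a' n‖ ≤ 1)
    (haa' : ∀ p ∈ P, ∀ m, 0 < m → a (p * m) = a' m) {y : ℝ} (hy : 0 < y) :
    ‖(∑ p ∈ P, b p) • interpolatedMean a y - ∑ p ∈ P, b p • interpolatedMean a' (y / p)‖ ≤
      √(∑ p ∈ P, b p + 2 * (∑ p ∈ P, b p) * #P * y⁻¹) + (∑ p ∈ P, b p + #P) * y⁻¹ := by
  have hbound := norm_sum_smul_integral_comp_natCeil_sub_le hP hpos hb0 hb1 ha ha' haa' hy.le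
  set S := ∑ p ∈ P, b p
  have hmeans : S • interpolatedMean a y - ∑ p ∈ P, b p • interpolatedMean a' (y / p) =
      y⁻¹ • (S • (∫ t in (0 : ℝ)..y, a ⌈t⌉₊)
        - ∑ p ∈ P, (p * b p) • ∫ t in (0 : ℝ)..(y / p), a' ⌈t⌉₊) := by
    simp_rw [interpolatedMean, smul_sub, smul_sum, smul_smul, inv_div, div_eq_mul_inv,
      mul_comm y⁻¹, ← mul_assoc, mul_comm (b _)]
  have hsqrt : √(y * S + 2 * S * #P) * √y = y * √(S + 2 * S * #P * y⁻¹) := by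
    have : y * S + 2 * S * #P = y * (S + 2 * S * #P * y⁻¹) := by field_simp
    rw [this, Real.sqrt_mul hy.le, mul_right_comm, Real.mul_self_sqrt hy.le]
  rw [hmeans, norm_smul, Real.norm_of_nonneg (inv_nonneg.2 hy.le), inv_mul_le_iff₀ hy]
  calc _ ≤ S + #P + y * √(S + 2 * S * #P * y⁻¹) := hsqrt ▸ hbound
    _ = y * (√(S + 2 * S * #P * y⁻¹) + (S + #P) * y⁻¹) := by field_simp; ring

theorem eventually_norm_sum_smul_interpolatedMean_sub_le (hP : (P : Set ℕ).Pairwise Nat.Coprime)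
    (hpos : ∀ p ∈ P, 0 < p) (hb0 : ∀ p ∈ P, 0 ≤ b p) (hb1 : ∀ p ∈ P, p * b p ≤ 1)
    (ha : ∀ n, ‖a n‖ ≤ 1) (ha' : ∀ n, ‖a' n‖ ≤ 1)
    (haa' : ∀ p ∈ P, ∀ m, 0 < m → a (p * m) = a' m) :
    ∀ᶠ y : ℝ in atTop,
      ‖(∑ p ∈ P, b p) • interpolatedMean a y - ∑ p ∈ P, b p • interpolatedMean a' (y / p)‖ ≤
        √(∑ p ∈ P, b p) + 1 := by
  set S := ∑ p ∈ P, b p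
  have hlim : Tendsto (fun y : ℝ => √(S + 2 * S * #P * y⁻¹) + (S + #P) * y⁻¹) atTop
      (𝓝 (√(S + 2 * S * #P * 0) + (S + #P) * 0)) :=
    ((tendsto_const_nhds.add (tendsto_inv_atTop_zero.const_mul _)).sqrt).add
      (tendsto_inv_atTop_zero.const_mul _)
  filter_upwards [hlim.eventually_le_const (u := √S + 1) (by simp), eventually_gt_atTop 0]
    with y hle hy
  exact (norm_sum_smul_interpolatedMean_sub_le hP hpos hb0 hb1 ha ha' haa' hy).trans hle

end DilationAverage

section ExponentialSum

open Finset Filter MeasureTheory SchwartzMap FourierTransform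

variable {ι : Type*} {s : Finset ι} {x : ι → ℝ} {k : 𝓢(ℝ, ℂ)} {M : ℝ}

/-- The exponential sum `∑_{i ∈ s} wᵢ exp(i t xᵢ)`. -/
noncomputable def expSum (s : Finset ι) (w x : ι → ℝ) (t : ℝ) : ℂ :=
  ∑ i ∈ s, w i * Complex.exp ((t * x i : ℝ) * Complex.I)

lemma contDiff_expSum {w : ι → ℝ} {n : WithTop ℕ∞} : ContDiff ℝ n (expSum s w x) := by
  refine ContDiff.sum fun i _ => contDiff_const.mul (ContDiff.cexp (ContDiff.mul ?_ contDiff_const))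
  exact Complex.ofRealCLM.contDiff.comp (contDiff_id.mul contDiff_const)

lemma fourier_expSum_mul (w : ι → ℝ) (v : ℝ) :
    𝓕 (fun t => expSum s w x (2 * Real.pi * t) * k t) v =
      ∑ i ∈ s, (w i : ℂ) * (𝓕⁻ k) (x i - v) := by
  have hterm (i : ι) (t : ℝ) : Complex.exp ((-2 * Real.pi * (t * v) : ℝ) * Complex.I) *
      (w i * Complex.exp ((2 * Real.pi * t * x i : ℝ) * Complex.I) * k t) =
        w i * (Complex.exp ((2 * Real.pi * (t * (x i - v)) : ℝ) * Complex.I) * k t) := by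
    rw [show ((2 * Real.pi * (t * (x i - v)) : ℝ) : ℂ) * Complex.I =
      ((-2 * Real.pi * (t * v) : ℝ) : ℂ) * Complex.I
        + ((2 * Real.pi * t * x i : ℝ) : ℂ) * Complex.I by push_cast; ring, Complex.exp_add]
    ring
  have hint (i : ι) : Integrable fun t : ℝ =>
      w i * (Complex.exp ((2 * Real.pi * (t * (x i - v)) : ℝ) * Complex.I) * k t) := by
    refine (k.integrable.norm.mono' ?_ (.of_forall fun t => ?_)).const_mul _
    · have := k.continuous
      exact Continuous.aestronglyMeasurable (by fun_prop)
    · rw [norm_mul, Complex.norm_exp_ofReal_mul_I, one_mul]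
  simp_rw [Real.fourier_eq', fourierInv_coe, Real.fourierInv_eq', expSum, smul_eq_mul, sum_mul,
    mul_sum, RCLike.inner_apply, conj_trivial, mul_comm v, hterm, mul_comm (x _ - v)]
  rw [integral_finsetSum _ fun i _ => hint i]
  simp_rw [integral_const_mul]

lemma integral_norm_sq_sum_fourierInv_sub_le (w : ι → ℝ) (hk : HasCompactSupport k)
    (hM : ∀ t, k t ≠ 0 → ‖expSum s w x (2 * Real.pi * t)‖ ≤ M) :
    ∫ v, ‖∑ i ∈ s, (w i : ℂ) * (𝓕⁻ k) (x i - v)‖ ^ 2 ≤ M ^ 2 * ∫ t, ‖k t‖ ^ 2 := by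
  have hsmooth : ContDiff ℝ (⊤ : ℕ∞) fun t => expSum s w x (2 * Real.pi * t) * k t :=
    (contDiff_expSum.comp (contDiff_const.mul contDiff_id)).mul (k.smooth _)
  have hsupp : HasCompactSupport fun t => expSum s w x (2 * Real.pi * t) * k t := hk.mul_left
  let K : 𝓢(ℝ, ℂ) := hsupp.toSchwartzMap hsmooth
  have hK (t : ℝ) : ‖K t‖ ^ 2 ≤ M ^ 2 * ‖k t‖ ^ 2 := by
    change ‖expSum s w x (2 * Real.pi * t) * k t‖ ^ 2 ≤ _
    rw [norm_mul, mul_pow]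
    by_cases h : k t = 0
    · simp [h]
    · gcongr
      exact hM t h
  have hF (v : ℝ) : ∑ i ∈ s, (w i : ℂ) * (𝓕⁻ k) (x i - v) = (𝓕 K) v := by
    rw [fourier_coe, ← fourier_expSum_mul]
    rfl
  simp_rw [hF]
  rw [integral_norm_sq_fourier, ← integral_const_mul]
  exact integral_mono ((K.memLp 2).integrable_norm_pow two_ne_zero)
    (((k.memLp 2).integrable_norm_pow two_ne_zero).const_mul _) hK

/-- The real part of the inverse Fourier transform of `k`, used as a smoothing kernel. It is real
so that it can act on functions with values in a real Banach space. -/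
noncomputable def smoothingKernel (k : 𝓢(ℝ, ℂ)) (v : ℝ) : ℝ := ((𝓕⁻ k) v).re

lemma continuous_smoothingKernel : Continuous (smoothingKernel k) :=
  Complex.continuous_re.comp (𝓕⁻ k).continuous

lemma abs_smoothingKernel_le (v : ℝ) : |smoothingKernel k v| ≤ ‖(𝓕⁻ k) v‖ :=
  Complex.abs_re_le_norm _

lemma memLp_smoothingKernel : MemLp (smoothingKernel k) 2 :=
  ((𝓕⁻ k).memLp 2 volume).re

lemma integrable_smoothingKernel : Integrable (smoothingKernel k) :=
  ((𝓕⁻ k).integrable (μ := volume)).re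

lemma integrable_abs_mul_smoothingKernel :
    Integrable fun v => |v| * |smoothingKernel k v| := by
  refine ((𝓕⁻ k).integrable_pow_mul volume 1).mono' ?_ (.of_forall fun v => ?_)
  · have := continuous_smoothingKernel (k := k)
    exact Continuous.aestronglyMeasurable (by fun_prop)
  · simp only [Real.norm_eq_abs, abs_mul, abs_abs, pow_one]
    gcongr
    exact abs_smoothingKernel_le v

lemma integral_smoothingKernel (hk : k 0 = 1) : ∫ v, smoothingKernel k v = 1 := by
  have h0 : ∫ v, (𝓕⁻ k) v = 1 := by
    have : (𝓕 (𝓕⁻ k)) 0 = 1 := by rw [FourierTransform.fourier_fourierInv_eq, hk]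
    rw [fourier_coe, Real.fourier_eq'] at this
    simpa using this
  calc ∫ v, smoothingKernel k v = (∫ v, (𝓕⁻ k) v).re := integral_re (𝓕⁻ k).integrable
    _ = 1 := by rw [h0, Complex.one_re]

lemma integral_norm_mul_norm_le_sqrt_mul_sqrt {α F G : Type*} [MeasurableSpace α]
    {μ : Measure α} [NormedAddCommGroup F] [NormedAddCommGroup G] {f : α → F} {g : α → G}
    (hf : MemLp f 2 μ) (hg : MemLp g 2 μ) :
    ∫ v, ‖f v‖ * ‖g v‖ ∂μ ≤ √(∫ v, ‖f v‖ ^ 2 ∂μ) * √(∫ v, ‖g v‖ ^ 2 ∂μ) := by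
  have := integral_mul_le_Lp_mul_Lq_of_nonneg (μ := μ) Real.HolderConjugate.two_two
    (f := fun v => ‖f v‖) (g := fun v => ‖g v‖) (.of_forall fun v => norm_nonneg _)
    (.of_forall fun v => norm_nonneg _) (by simpa using hf.norm) (by simpa using hg.norm)
  simpa only [Real.rpow_two, ← Real.sqrt_eq_rpow] using this

variable {E : Type*} [NormedAddCommGroup E] [NormedSpace ℝ E]

lemma sum_smul_integral_smoothingKernel (w : ι → ℝ) {h : ℝ → E} (hh : MemLp h 2) :
    ∑ i ∈ s, w i • ∫ v, smoothingKernel k (x i - v) • h v =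
      ∫ v, (∑ i ∈ s, (w i : ℂ) * (𝓕⁻ k) (x i - v)).re • h v := by
  have hint (i : ι) : Integrable fun v => w i • smoothingKernel k (x i - v) • h v :=
    (memLp_one_iff_integrable.1 <| hh.smul <| memLp_smoothingKernel.comp_measurePreserving <|
      Measure.measurePreserving_sub_left volume (x i)).smul (w i)
  simp_rw [← integral_smul]
  rw [← integral_finsetSum _ fun i _ => hint i]
  simp [smoothingKernel, sum_smul, mul_smul]

lemma norm_sum_smul_integral_smoothingKernel_le (w : ι → ℝ) (hk : HasCompactSupport k)
    (hM0 : 0 ≤ M) (hM : ∀ t, k t ≠ 0 → ‖expSum s w x (2 * Real.pi * t)‖ ≤ M)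
    {h : ℝ → E} (hh : MemLp h 2) :
    ‖∑ i ∈ s, w i • ∫ v, smoothingKernel k (x i - v) • h v‖ ≤
      M * √(∫ t, ‖k t‖ ^ 2) * √(∫ v, ‖h v‖ ^ 2) := by
  set Φ : ℝ → ℂ := fun v => ∑ i ∈ s, (w i : ℂ) * (𝓕⁻ k) (x i - v)
  have hΦ : MemLp Φ 2 :=
    memLp_finsetSum _ fun i _ => (((𝓕⁻ k).memLp 2 volume).comp_measurePreserving
      (Measure.measurePreserving_sub_left volume (x i))).const_mul _
  calc ‖∑ i ∈ s, w i • ∫ v, smoothingKernel k (x i - v) • h v‖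
      ≤ ∫ v, ‖Φ v‖ * ‖h v‖ := by
        rw [sum_smul_integral_smoothingKernel w hh]
        refine norm_integral_le_of_norm_le (hΦ.norm.integrable_mul hh.norm) (.of_forall fun v => ?_)
        rw [norm_smul]
        gcongr
        exact Complex.abs_re_le_norm _
    _ ≤ √(∫ v, ‖Φ v‖ ^ 2) * √(∫ v, ‖h v‖ ^ 2) := integral_norm_mul_norm_le_sqrt_mul_sqrt hΦ hh
    _ ≤ √(M ^ 2 * ∫ t, ‖k t‖ ^ 2) * √(∫ v, ‖h v‖ ^ 2) := by
        gcongr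
        exact integral_norm_sq_sum_fourierInv_sub_le w hk hM
    _ = M * √(∫ t, ‖k t‖ ^ 2) * √(∫ v, ‖h v‖ ^ 2) := by
        rw [Real.sqrt_mul (sq_nonneg M), Real.sqrt_sq hM0]

lemma norm_sum_smul_integral_smoothingKernel_scaled_le
    (hk : ∀ t, k t ≠ 0 → |2 * Real.pi * t| ≤ 1) (w : ι → ℝ) {R : ℝ} (hR : 0 < R)
    (hM : ∀ t, |t| ≤ R → ‖expSum s w x t‖ ≤ M) {h : ℝ → E} (hcont : Continuous h)
    (hh : MemLp h 2) :
    ‖∑ i ∈ s, w i • ∫ v, smoothingKernel k (R * x i - v) • h (v / R)‖ ≤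
      √R * M * √(∫ t, ‖k t‖ ^ 2) * √(∫ v, ‖h v‖ ^ 2) := by
  have hM0 : 0 ≤ M := (norm_nonneg _).trans (hM 0 (by simpa using hR.le))
  have hcompact : HasCompactSupport k := by
    refine .of_support_subset_isCompact (isCompact_closedBall 0 (2 * Real.pi)⁻¹) fun t ht => ?_
    rw [mem_closedBall_zero_iff, Real.norm_eq_abs, ← one_div, le_div_iff₀' Real.two_pi_pos]
    simpa [abs_mul, abs_of_pos Real.pi_pos] using hk t ht
  have hscale (t : ℝ) : expSum s w (fun i => R * x i) (2 * Real.pi * t) =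
      expSum s w x (2 * Real.pi * t * R) := by simp only [expSum, mul_assoc]
  have hMR (t : ℝ) (ht : k t ≠ 0) : ‖expSum s w (fun i => R * x i) (2 * Real.pi * t)‖ ≤ M := by
    rw [hscale]
    apply hM
    rw [abs_mul, abs_of_pos hR]
    exact mul_le_of_le_one_left hR.le (hk t ht)
  have hhR : MemLp (fun v => h (v / R)) 2 := by
    rw [memLp_two_iff_integrable_sq_norm (by fun_prop)] at hh ⊢
    exact hh.comp_div hR.ne'
  have hnorm : √(∫ v, ‖h (v / R)‖ ^ 2) = √R * √(∫ v, ‖h v‖ ^ 2) := by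
    rw [← Real.sqrt_mul hR.le, Measure.integral_comp_div (fun v => ‖h v‖ ^ 2) R, abs_of_pos hR,
      smul_eq_mul]
  calc _ ≤ M * √(∫ t, ‖k t‖ ^ 2) * √(∫ v, ‖h (v / R)‖ ^ 2) :=
        norm_sum_smul_integral_smoothingKernel_le w hcompact hM0 hMR hhR
    _ = √R * M * √(∫ t, ‖k t‖ ^ 2) * √(∫ v, ‖h v‖ ^ 2) := by rw [hnorm]; ring

variable [CompleteSpace E]

lemma norm_sub_integral_smoothingKernel_smul_le (hk : k 0 = 1) {h : ℝ → E} (hcont : Continuous h)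
    {u c R : ℝ} (hc : ∀ v, ‖h u - h v‖ ≤ c * |u - v|) (hR : 0 < R) :
    ‖h u - ∫ v, smoothingKernel k (R * u - v) • h (v / R)‖ ≤
      (∫ v, |v| * |smoothingKernel k v|) / R * c := by
  set ψ := smoothingKernel k
  have hbound (v : ℝ) : ‖ψ v • (h u - h (u - v / R))‖ ≤ c / R * (|v| * |ψ v|) := by
    have hdiff := hc (u - v / R)
    rw [sub_sub_cancel, abs_div, abs_of_pos hR] at hdiff
    calc ‖ψ v • (h u - h (u - v / R))‖ ≤ |ψ v| * (c * (|v| / R)) := by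
          rw [norm_smul, Real.norm_eq_abs]
          gcongr
      _ = c / R * (|v| * |ψ v|) := by ring
  have hmajorant := (integrable_abs_mul_smoothingKernel (k := k)).const_mul (c / R)
  have hdiff : Integrable fun v => ψ v • (h u - h (u - v / R)) := by
    have := continuous_smoothingKernel (k := k)
    exact hmajorant.mono' (Continuous.aestronglyMeasurable (by fun_prop)) (.of_forall hbound)
  have hconst : Integrable fun v => ψ v • h u := integrable_smoothingKernel.smul_const _
  have hshift : ∫ v, ψ (R * u - v) • h (v / R) = ∫ v, ψ v • h (u - v / R) := by
    rw [← integral_sub_left_eq_self _ volume (R * u)]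
    simp only [sub_sub_cancel, sub_div, mul_div_cancel_left₀ _ hR.ne']
  have hsub : h u - ∫ v, ψ (R * u - v) • h (v / R) = ∫ v, ψ v • (h u - h (u - v / R)) := by
    have hmass : h u = ∫ v, ψ v • h u := by
      rw [integral_smul_const, integral_smoothingKernel hk, one_smul]
    have hsecond : ∫ v, ψ v • h (u - v / R) =
        ∫ v, (ψ v • h u - ψ v • (h u - h (u - v / R))) := by
      simp_rw [smul_sub, sub_sub_cancel]
    rw [hshift, hsecond, integral_sub hconst hdiff, ← hmass, sub_sub_cancel]
  rw [hsub]
  exact (norm_integral_le_of_norm_le hmajorant (.of_forall hbound)).trans_eq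
    (by rw [integral_const_mul]; ring)

-- Smoothing `h` at scale `1 / R` restricts the spectrum to `[-R, R]`.
theorem norm_sum_smul_le_of_norm_expSum_le (hk0 : k 0 = 1)
    (hk : ∀ t, k t ≠ 0 → |2 * Real.pi * t| ≤ 1) (w : ι → ℝ) {R : ℝ} (hR : 0 < R)
    (hM : ∀ t, |t| ≤ R → ‖expSum s w x t‖ ≤ M) {h : ℝ → E} (hh : MemLp h 2) {m : ℝ → ℝ}
    (hm : ∀ u v, ‖h u - h v‖ ≤ m u * |u - v|) :
    ‖∑ i ∈ s, w i • h (x i)‖ ≤ √R * M * √(∫ t, ‖k t‖ ^ 2) * √(∫ v, ‖h v‖ ^ 2)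
      + (∫ v, |v| * |smoothingKernel k v|) / R * ∑ i ∈ s, |w i| * m (x i) := by
  have hcont : Continuous h := continuous_iff_continuousAt.2 fun u =>
    continuousAt_of_locally_lipschitz one_pos (m u) fun v _ => by
      simpa only [dist_comm _ u, dist_comm _ (h u), dist_eq_norm, Real.norm_eq_abs] using hm u v
  set J : ι → E := fun i => ∫ v, smoothingKernel k (R * x i - v) • h (v / R)
  have hsmooth : ‖∑ i ∈ s, w i • J i‖ ≤ √R * M * √(∫ t, ‖k t‖ ^ 2) * √(∫ v, ‖h v‖ ^ 2) :=
    norm_sum_smul_integral_smoothingKernel_scaled_le hk w hR hM hcont hh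
  have hrest : ‖∑ i ∈ s, w i • (h (x i) - J i)‖ ≤
      (∫ v, |v| * |smoothingKernel k v|) / R * ∑ i ∈ s, |w i| * m (x i) := by
    rw [mul_sum]
    refine norm_sum_le_of_le _ fun i _ => ?_
    rw [norm_smul, Real.norm_eq_abs, mul_left_comm]
    gcongr
    exact norm_sub_integral_smoothingKernel_smul_le hk0 hcont (hm (x i)) hR
  have hsplit : ∑ i ∈ s, w i • h (x i) = ∑ i ∈ s, w i • J i + ∑ i ∈ s, w i • (h (x i) - J i) := by
    simp_rw [smul_sub, sum_sub_distrib, add_sub_cancel]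
  rw [hsplit]
  exact norm_add_le_of_le hsmooth hrest

lemma exists_schwartzMap_apply_zero_eq_one :
    ∃ k : 𝓢(ℝ, ℂ), k 0 = 1 ∧ ∀ t, k t ≠ 0 → |2 * Real.pi * t| ≤ 1 := by
  let β : ContDiffBump (0 : ℝ) := ⟨1 / 16, 1 / 8, by norm_num, by norm_num⟩
  have hsmooth : ContDiff ℝ (⊤ : ℕ∞) fun t : ℝ => ((β t : ℝ) : ℂ) :=
    Complex.ofRealCLM.contDiff.comp β.contDiff
  have hsupp : HasCompactSupport fun t : ℝ => ((β t : ℝ) : ℂ) :=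
    β.hasCompactSupport.comp_left Complex.ofReal_zero
  refine ⟨hsupp.toSchwartzMap hsmooth, ?_, fun t ht => ?_⟩
  · change ((β 0 : ℝ) : ℂ) = 1
    rw [β.one_of_mem_closedBall (Metric.mem_closedBall_self (by norm_num [β])),
      Complex.ofReal_one]
  · have hβ : t ∈ Function.support β := fun h0 => ht (congrArg Complex.ofReal h0)
    have ht8 : |t| < 1 / 8 := by rwa [β.support_eq, mem_ball_zero_iff] at hβ
    rw [abs_mul, abs_of_pos Real.two_pi_pos]
    nlinarith [Real.pi_pos, Real.pi_lt_four, abs_nonneg t]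

end ExponentialSum

section PrimeSum

open Finset Filter ArithmeticFunction ArithmeticFunction.vonMangoldt

lemma norm_ofReal_mul_exp_ofReal_mul_I (r θ : ℝ) :
    ‖(r : ℂ) * Complex.exp (θ * Complex.I)‖ = |r| := by
  rw [norm_mul, Complex.norm_exp_ofReal_mul_I, mul_one, Complex.norm_real, Real.norm_eq_abs]

lemma norm_expSum_le {ι : Type*} (s : Finset ι) (w x : ι → ℝ) (t : ℝ) :
    ‖expSum s w x t‖ ≤ ∑ i ∈ s, |w i| :=
  norm_sum_le_of_le _ fun _ _ => (norm_ofReal_mul_exp_ofReal_mul_I _ _).le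

lemma norm_one_sub_exp_ofReal_mul_I_le_two (θ : ℝ) : ‖1 - Complex.exp (θ * Complex.I)‖ ≤ 2 := by
  have := norm_sub_le 1 (Complex.exp (θ * Complex.I))
  rwa [Complex.norm_exp_ofReal_mul_I, norm_one, one_add_one_eq_two] at this

lemma residueClass_zmod_one : residueClass (1 : ZMod 1) = vonMangoldt :=
  funext fun _ => Set.indicator_of_mem (s := {n : ℕ | (n : ZMod 1) = 1}) (Subsingleton.elim _ _) _

-- The analytic input: `ζ'/ζ + 1 / (z - 1)` is continuous up to the line `re z = 1`.
lemma exists_norm_LSeries_vonMangoldt_sub_inv_le (R : ℝ) :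
    ∃ C : ℝ, ∀ σ ∈ Set.Ioc (0 : ℝ) 1, ∀ t : ℝ, |t| ≤ R →
      ‖LSeries (fun n => (vonMangoldt n : ℂ)) (1 + σ - t * Complex.I)
        - (σ - t * Complex.I)⁻¹‖ ≤ C := by
  have hcont : ContinuousOn
      (fun z : ℝ × ℝ => LFunctionResidueClassAux (1 : ZMod 1) (1 + z.1 - z.2 * Complex.I))
      (Set.Icc 0 1 ×ˢ Set.Icc (-R) R) :=
    (continuousOn_LFunctionResidueClassAux (1 : ZMod 1)).comp (by fun_prop)
      fun z hz => by simpa using hz.1.1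
  obtain ⟨C, hC⟩ := (isCompact_Icc.prod isCompact_Icc).exists_bound_of_continuousOn hcont
  refine ⟨C, fun σ hσ t ht => ?_⟩
  have haux := eqOn_LFunctionResidueClassAux (isUnit_one (M := ZMod 1))
    (show 1 + (σ : ℂ) - t * Complex.I ∈ {z : ℂ | 1 < z.re} by simpa using hσ.1)
  simp only [residueClass_zmod_one, Nat.totient_one, Nat.cast_one, inv_one, add_sub_assoc, one_div,
    add_sub_cancel (1 : ℂ)] at haux
  rw [add_sub_assoc, ← haux, ← add_sub_assoc]
  exact hC (σ, t) ⟨⟨hσ.1.le, hσ.2⟩, abs_le.1 ht⟩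

lemma norm_one_sub_exp_mul_inv_le (s σ t : ℝ) :
    ‖(1 - Complex.exp ((t * s : ℝ) * Complex.I)) * (σ - t * Complex.I)⁻¹‖ ≤ |s| := by
  have hexp : ‖1 - Complex.exp ((t * s : ℝ) * Complex.I)‖ ≤ |t| * |s| := by
    rw [norm_sub_rev, mul_comm _ Complex.I, ← abs_mul]
    exact Real.norm_exp_I_mul_ofReal_sub_one_le
  have him : |t| ≤ ‖(σ - t * Complex.I : ℂ)‖ := by
    simpa using Complex.abs_im_le_norm (σ - t * Complex.I)
  rw [norm_mul, norm_inv, ← div_eq_mul_inv]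
  exact div_le_of_le_mul₀ (norm_nonneg _) (abs_nonneg s)
    (hexp.trans (by rw [mul_comm]; gcongr))

lemma exists_norm_one_sub_exp_mul_LSeries_vonMangoldt_le (R s : ℝ) :
    ∃ M : ℝ, ∀ σ ∈ Set.Ioc (0 : ℝ) 1, ∀ t : ℝ, |t| ≤ R →
      ‖(1 - Complex.exp ((t * s : ℝ) * Complex.I)) *
        LSeries (fun n => (vonMangoldt n : ℂ)) (1 + σ - t * Complex.I)‖ ≤ M := by
  obtain ⟨C, hC⟩ := exists_norm_LSeries_vonMangoldt_sub_inv_le R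
  refine ⟨2 * C + |s|, fun σ hσ t ht => ?_⟩
  rw [← sub_add_cancel (LSeries _ _) (σ - t * Complex.I)⁻¹, mul_add]
  refine norm_add_le_of_le ?_ (norm_one_sub_exp_mul_inv_le s σ t)
  rw [norm_mul]
  gcongr
  · exact norm_one_sub_exp_ofReal_mul_I_le_two _
  · exact hC σ hσ t ht

/-- The weight `Λ(n) / n ^ (1 + σ)`, i.e. the `n`-th term of `-ζ'/ζ` at `1 + σ`. -/
noncomputable def mangoldtWeight (σ : ℝ) (n : ℕ) : ℝ := vonMangoldt n * (n : ℝ) ^ (-(1 + σ))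

lemma mangoldtWeight_nonneg (σ : ℝ) (n : ℕ) : 0 ≤ mangoldtWeight σ n :=
  mul_nonneg vonMangoldt_nonneg (by positivity)

lemma mangoldtWeight_le {σ : ℝ} (hσ : 0 ≤ σ) (n : ℕ) :
    mangoldtWeight σ n ≤ vonMangoldt n / n := by
  rcases n.eq_zero_or_pos with rfl | hn
  · simp [mangoldtWeight]
  · rw [mangoldtWeight, div_eq_mul_inv, ← Real.rpow_neg_one]
    exact mul_le_mul_of_nonneg_left
      (Real.rpow_le_rpow_of_exponent_le (by exact_mod_cast hn) (by linarith)) vonMangoldt_nonneg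

lemma LSeries_term_vonMangoldt_eq (σ t : ℝ) (n : ℕ) :
    LSeries.term (fun n => (vonMangoldt n : ℂ)) (1 + σ - t * Complex.I) n =
      mangoldtWeight σ n * Complex.exp ((t * Real.log n : ℝ) * Complex.I) := by
  rcases n.eq_zero_or_pos with rfl | hn
  · simp [mangoldtWeight]
  · have hn0 : (n : ℂ) ≠ 0 := by exact_mod_cast hn.ne'
    rw [LSeries.term_of_ne_zero hn.ne', mangoldtWeight, div_eq_mul_inv, ← Complex.cpow_neg,
      Complex.ofReal_mul, Complex.ofReal_cpow (by positivity), mul_assoc, Complex.ofReal_natCast,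
      Complex.cpow_def_of_ne_zero hn0, Complex.cpow_def_of_ne_zero hn0, ← Complex.exp_add,
      ← Complex.natCast_log]
    congr 2
    push_cast
    ring

variable {σ : ℝ}

lemma summable_mangoldtWeight (hσ : 0 < σ) : Summable (mangoldtWeight σ) := by
  have hsum : LSeriesSummable (fun n => (vonMangoldt n : ℂ)) (1 + σ - (0 : ℝ) * Complex.I) :=
    LSeriesSummable_vonMangoldt (by simpa using hσ)
  refine hsum.norm.congr fun n => ?_
  rw [LSeries_term_vonMangoldt_eq, norm_ofReal_mul_exp_ofReal_mul_I,
    abs_of_nonneg (mangoldtWeight_nonneg σ n)]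

lemma norm_LSeries_vonMangoldt_sub_expSum_range_le (hσ : 0 < σ) (t : ℝ) (X : ℕ) :
    ‖LSeries (fun n => (vonMangoldt n : ℂ)) (1 + σ - t * Complex.I)
      - expSum (range X) (mangoldtWeight σ) (fun n => Real.log n) t‖ ≤
        ∑' n, mangoldtWeight σ (n + X) := by
  have hsum : LSeriesSummable (fun n => (vonMangoldt n : ℂ)) (1 + σ - t * Complex.I) :=
    LSeriesSummable_vonMangoldt (by simpa using hσ)
  rw [LSeries, ← hsum.sum_add_tsum_nat_add X, expSum]
  simp_rw [LSeries_term_vonMangoldt_eq, add_sub_cancel_left]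
  refine tsum_of_norm_bounded ((summable_nat_add_iff X).2 (summable_mangoldtWeight hσ)).hasSum
    fun n => ?_
  rw [norm_ofReal_mul_exp_ofReal_mul_I, abs_of_nonneg (mangoldtWeight_nonneg _ _)]

lemma norm_expSum_filter_not_prime_le (hσ : 0 ≤ σ) (t : ℝ) (X : ℕ) :
    ‖expSum {n ∈ range X | ¬ n.Prime} (mangoldtWeight σ) (fun n => Real.log n) t‖ ≤
      ∑' n : ℕ, (if n.Prime then 0 else vonMangoldt n) / n := by
  have hsum := summable_residueClass_non_primes_div (1 : ZMod 1)
  simp only [residueClass_zmod_one] at hsum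
  have hnonneg (n : ℕ) : 0 ≤ (if n.Prime then 0 else vonMangoldt n) / (n : ℝ) := by
    have : 0 ≤ vonMangoldt n := vonMangoldt_nonneg
    positivity
  refine (norm_expSum_le _ _ _ _).trans (le_trans ?_
    (hsum.sum_le_tsum {n ∈ range X | ¬ n.Prime} fun n _ => hnonneg n))
  refine sum_le_sum fun n hn => ?_
  rw [abs_of_nonneg (mangoldtWeight_nonneg σ n), if_neg (mem_filter.1 hn).2]
  exact mangoldtWeight_le hσ n

-- The factor `1 - exp (i t s)` cancels the pole of `-ζ'/ζ`, so that the bound is uniform in `σ`.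
theorem exists_eventually_norm_one_sub_exp_mul_expSum_prime_le (R s : ℝ) :
    ∃ M : ℝ, ∀ σ ∈ Set.Ioc (0 : ℝ) 1, ∀ᶠ X : ℕ in atTop, ∀ t : ℝ, |t| ≤ R →
      ‖(1 - Complex.exp ((t * s : ℝ) * Complex.I)) *
        expSum {p ∈ range X | p.Prime} (mangoldtWeight σ) (fun p => Real.log p) t‖ ≤ M := by
  obtain ⟨M, hM⟩ := exists_norm_one_sub_exp_mul_LSeries_vonMangoldt_le R s
  set K := ∑' n : ℕ, (if n.Prime then 0 else vonMangoldt n) / (n : ℝ)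
  refine ⟨M + 2 * (1 + K), fun σ hσ => ?_⟩
  filter_upwards [(tendsto_sum_nat_add (mangoldtWeight σ)).eventually_le_const zero_lt_one]
    with X hX t ht
  set e := 1 - Complex.exp ((t * s : ℝ) * Complex.I)
  set L := LSeries (fun n => (vonMangoldt n : ℂ)) (1 + σ - t * Complex.I)
  set x : ℕ → ℝ := fun n => Real.log n
  have hsplit : expSum {p ∈ range X | p.Prime} (mangoldtWeight σ) x t =
      L - ((L - expSum (range X) (mangoldtWeight σ) x t)
        + expSum {n ∈ range X | ¬ n.Prime} (mangoldtWeight σ) x t) := by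
    have : expSum {p ∈ range X | p.Prime} (mangoldtWeight σ) x t
        + expSum {n ∈ range X | ¬ n.Prime} (mangoldtWeight σ) x t =
          expSum (range X) (mangoldtWeight σ) x t :=
      sum_filter_add_sum_filter_not _ _ _
    rw [← this]
    abel
  rw [hsplit, mul_sub]
  refine norm_sub_le_of_le (hM σ hσ t ht) ?_
  rw [norm_mul]
  exact mul_le_mul (norm_one_sub_exp_ofReal_mul_I_le_two _)
    (norm_add_le_of_le ((norm_LSeries_vonMangoldt_sub_expSum_range_le hσ.1 t X).trans hX)
      (norm_expSum_filter_not_prime_le hσ.1.le t X)) (norm_nonneg _) zero_le_two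

end PrimeSum

section Shift

open Finset Filter Topology MeasureTheory SchwartzMap
open scoped NNReal

lemma continuous_inv_one_add_abs : Continuous fun u : ℝ => (1 + |u|)⁻¹ :=
  (by fun_prop : Continuous fun u : ℝ => 1 + |u|).inv₀ fun u => by positivity

lemma integrable_inv_one_add_abs_sq : Integrable fun u : ℝ => (1 + |u|)⁻¹ ^ 2 := by
  refine (integrable_one_add_norm (E := ℝ) (μ := volume) (r := 2) (by simp)).congr
    (.of_forall fun u => ?_)
  simp only [Real.norm_eq_abs]
  rw [Real.rpow_neg (by positivity), Real.rpow_two, inv_pow]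

variable {E : Type*} [NormedAddCommGroup E] [NormedSpace ℝ E] {g : ℝ → E} {L : ℝ≥0}

lemma norm_inv_one_add_abs_smul_sub_le (hg1 : ∀ u, ‖g u‖ ≤ 1) (hg : LipschitzWith L g) (u v : ℝ) :
    ‖(1 + |u|)⁻¹ • g u - (1 + |v|)⁻¹ • g v‖ ≤ (L + 1) * (1 + |u|)⁻¹ * |u - v| := by
  have hinv : |(1 + |u|)⁻¹ - (1 + |v|)⁻¹| ≤ (1 + |u|)⁻¹ * |u - v| := by
    have hv : (1 + |v|)⁻¹ ≤ 1 := inv_le_one_of_one_le₀ (by simp)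
    rw [inv_sub_inv (by positivity) (by positivity), add_sub_add_left_eq_sub, div_eq_mul_inv,
      mul_inv, abs_mul, abs_mul, abs_of_pos (inv_pos.2 (by positivity : 0 < 1 + |u|)),
      abs_of_pos (inv_pos.2 (by positivity : 0 < 1 + |v|)), mul_left_comm, abs_sub_comm u]
    gcongr
    exact (mul_le_of_le_one_right (abs_nonneg _) hv).trans (abs_abs_sub_abs_le v u)
  have hgu : ‖g u - g v‖ ≤ L * |u - v| := by
    simpa [dist_eq_norm] using hg.dist_le_mul u v
  have hsplit : (1 + |u|)⁻¹ • g u - (1 + |v|)⁻¹ • g v =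
      (1 + |u|)⁻¹ • (g u - g v) + ((1 + |u|)⁻¹ - (1 + |v|)⁻¹) • g v := by module
  rw [hsplit]
  calc _ ≤ (1 + |u|)⁻¹ * (L * |u - v|) + (1 + |u|)⁻¹ * |u - v| * 1 := by
        refine norm_add_le_of_le ?_ ?_
        · rw [norm_smul, Real.norm_of_nonneg (by positivity)]
          gcongr
        · rw [norm_smul, Real.norm_eq_abs]
          gcongr
          exact hg1 v
    _ = (L + 1) * (1 + |u|)⁻¹ * |u - v| := by ring

lemma norm_inv_one_add_abs_smul_sq_le (hg1 : ∀ u, ‖g u‖ ≤ 1) (u : ℝ) :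
    ‖(1 + |u|)⁻¹ • g u‖ ^ 2 ≤ (1 + |u|)⁻¹ ^ 2 := by
  rw [norm_smul, Real.norm_of_nonneg (by positivity)]
  gcongr
  exact mul_le_of_le_one_right (by positivity) (hg1 u)

lemma integrable_norm_inv_one_add_abs_smul_sq (hg1 : ∀ u, ‖g u‖ ≤ 1) (hg : Continuous g) :
    Integrable fun u => ‖(1 + |u|)⁻¹ • g u‖ ^ 2 := by
  have := continuous_inv_one_add_abs
  refine integrable_inv_one_add_abs_sq.mono' (by fun_prop) (.of_forall fun u => ?_)
  simpa using norm_inv_one_add_abs_smul_sq_le hg1 u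

lemma memLp_inv_one_add_abs_smul (hg1 : ∀ u, ‖g u‖ ≤ 1) (hg : Continuous g) :
    MemLp (fun u => (1 + |u|)⁻¹ • g u) 2 := by
  have := continuous_inv_one_add_abs
  exact (memLp_two_iff_integrable_sq_norm (by fun_prop)).2
    (integrable_norm_inv_one_add_abs_smul_sq hg1 hg)

variable {ι : Type*} {P : Finset ι} {b x : ι → ℝ} {s R M : ℝ}

lemma expSum_disjSum_shift (b x : ι → ℝ) (s t : ℝ) :
    expSum (P.disjSum P) (Sum.elim b (-b)) (Sum.elim x fun i => x i + s) t =
      (1 - Complex.exp ((t * s : ℝ) * Complex.I)) * expSum P b x t := by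
  simp only [expSum, sum_disjSum, Sum.elim_inl, Sum.elim_inr, mul_sum, ← sum_add_distrib]
  refine sum_congr rfl fun i _ => ?_
  rw [mul_add, Complex.ofReal_add, add_mul, Complex.exp_add, Pi.neg_apply, Complex.ofReal_neg]
  ring

lemma norm_div_one_add_smul_sub_le (hg1 : ∀ u, ‖g u‖ ≤ 1) (hs : 0 ≤ s) {β u : ℝ} (hβ : 0 ≤ β)
    (hu : 0 ≤ u) :
    ‖(β / (1 + u)) • (g u - g (u + s))
      - β • ((1 + |u|)⁻¹ • g u - (1 + |u + s|)⁻¹ • g (u + s))‖ ≤ s * (β / (1 + u) ^ 2) := by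
  have hsplit : (β / (1 + u)) • (g u - g (u + s))
      - β • ((1 + |u|)⁻¹ • g u - (1 + |u + s|)⁻¹ • g (u + s)) =
        -(β * (s / ((1 + u) * (1 + u + s)))) • g (u + s) := by
    have : (1 + u)⁻¹ - (1 + (u + s))⁻¹ = s / ((1 + u) * (1 + u + s)) := by field_simp; ring
    rw [← this, abs_of_nonneg hu, abs_of_nonneg (add_nonneg hu hs), div_eq_mul_inv]
    module
  rw [hsplit, norm_smul, norm_neg, Real.norm_of_nonneg (by positivity)]
  calc _ ≤ β * (s / ((1 + u) * (1 + u + 0))) * 1 := by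
        gcongr
        exact hg1 _
    _ = s * (β / (1 + u) ^ 2) := by ring

lemma sum_abs_mul_inv_one_add_abs_add_le (hs : 0 ≤ s) (hb : ∀ i ∈ P, 0 ≤ b i)
    (hx : ∀ i ∈ P, 0 ≤ x i) {c : ℝ} (hc : 0 ≤ c) :
    ∑ i ∈ P, |b i| * (c * (1 + |x i|)⁻¹ + c * (1 + |x i + s|)⁻¹) ≤
      2 * c * ∑ i ∈ P, b i / (1 + x i) := by
  rw [mul_sum]
  refine sum_le_sum fun i hi => ?_
  have hbi := hb i hi
  have hxi := hx i hi
  rw [abs_of_nonneg hbi, abs_of_nonneg hxi, abs_of_nonneg (add_nonneg hxi hs)]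
  calc _ ≤ b i * (c * (1 + x i)⁻¹ + c * (1 + (x i + 0))⁻¹) := by gcongr
    _ = 2 * c * (b i / (1 + x i)) := by ring

variable [CompleteSpace E]

lemma norm_sum_smul_sub_shift_le {k : 𝓢(ℝ, ℂ)} (hk0 : k 0 = 1)
    (hk : ∀ t, k t ≠ 0 → |2 * Real.pi * t| ≤ 1) (hR : 0 < R)
    (hM : ∀ t, |t| ≤ R → ‖(1 - Complex.exp ((t * s : ℝ) * Complex.I)) * expSum P b x t‖ ≤ M)
    {h : ℝ → E} (hh : MemLp h 2) {m : ℝ → ℝ} (hm : ∀ u v, ‖h u - h v‖ ≤ m u * |u - v|) :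
    ‖∑ i ∈ P, b i • (h (x i) - h (x i + s))‖ ≤ √R * M * √(∫ t, ‖k t‖ ^ 2) * √(∫ v, ‖h v‖ ^ 2)
      + (∫ v, |v| * |smoothingKernel k v|) / R * ∑ i ∈ P, |b i| * (m (x i) + m (x i + s)) := by
  have := norm_sum_smul_le_of_norm_expSum_le hk0 hk (s := P.disjSum P)
    (x := Sum.elim x fun i => x i + s) (Sum.elim b (-b)) hR
    (fun t ht => (congrArg norm (expSum_disjSum_shift b x s t)).trans_le (hM t ht)) hh hm
  simpa only [sum_disjSum, Sum.elim_inl, Sum.elim_inr, Pi.neg_apply, abs_neg, neg_smul, smul_sub,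
    sum_neg_distrib, sum_sub_distrib, mul_add, sum_add_distrib, ← sub_eq_add_neg] using this

-- Dividing the bounded function `g` by `1 + |u|` makes it square integrable.
variable (ι E) in
theorem exists_norm_sum_div_one_add_smul_shift_le :
    ∃ C : ℝ, 0 ≤ C ∧ ∀ (P : Finset ι) (b x : ι → ℝ) (s R M : ℝ), (∀ i ∈ P, 0 ≤ b i) →
      (∀ i ∈ P, 0 ≤ x i) → 0 ≤ s → 0 < R →
      (∀ t, |t| ≤ R → ‖(1 - Complex.exp ((t * s : ℝ) * Complex.I)) * expSum P b x t‖ ≤ M) →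
      ∀ (g : ℝ → E) (L : ℝ≥0), (∀ u, ‖g u‖ ≤ 1) → LipschitzWith L g →
      ‖∑ i ∈ P, (b i / (1 + x i)) • (g (x i) - g (x i + s))‖ ≤
        C * √R * M + C * (L + 1) / R * ∑ i ∈ P, b i / (1 + x i)
          + s * ∑ i ∈ P, b i / (1 + x i) ^ 2 := by
  obtain ⟨k, hk0, hk⟩ := exists_schwartzMap_apply_zero_eq_one
  set B := √(∫ v : ℝ, (1 + |v|)⁻¹ ^ 2)
  set A := √(∫ t, ‖k t‖ ^ 2) * B
  set κ := ∫ v, |v| * |smoothingKernel k v|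
  have : 0 ≤ κ := integral_nonneg fun v => by positivity
  refine ⟨max A (2 * κ), le_max_of_le_right (by positivity),
    fun P b x s R M hb hx hs hR hM g L hg1 hg => ?_⟩
  have hM0 : 0 ≤ M := (norm_nonneg _).trans (hM 0 (by simpa using hR.le))
  set h : ℝ → E := fun u => (1 + |u|)⁻¹ • g u
  have hmain := norm_sum_smul_sub_shift_le hk0 hk hR hM
    (memLp_inv_one_add_abs_smul hg1 hg.continuous) (norm_inv_one_add_abs_smul_sub_le hg1 hg)
  have herr : ‖∑ i ∈ P, ((b i / (1 + x i)) • (g (x i) - g (x i + s))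
      - b i • (h (x i) - h (x i + s)))‖ ≤ s * ∑ i ∈ P, b i / (1 + x i) ^ 2 := by
    rw [mul_sum]
    exact norm_sum_le_of_le _ fun i hi => norm_div_one_add_smul_sub_le hg1 hs (hb i hi) (hx i hi)
  have hL2 : √(∫ v, ‖h v‖ ^ 2) ≤ B :=
    Real.sqrt_le_sqrt <| integral_mono (integrable_norm_inv_one_add_abs_smul_sq hg1 hg.continuous)
      integrable_inv_one_add_abs_sq (norm_inv_one_add_abs_smul_sq_le hg1)
  rw [← sub_add_cancel (∑ i ∈ P, (b i / (1 + x i)) • (g (x i) - g (x i + s)))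
    (∑ i ∈ P, b i • (h (x i) - h (x i + s))), ← sum_sub_distrib, add_comm]
  refine norm_add_le_of_le (hmain.trans (add_le_add ?_ ?_)) herr
  · calc _ ≤ √R * M * √(∫ t, ‖k t‖ ^ 2) * B := by gcongr
      _ = A * √R * M := by ring
      _ ≤ max A (2 * κ) * √R * M := by gcongr; exact le_max_left _ _
  · have hW : 0 ≤ ∑ i ∈ P, b i / (1 + x i) :=
      sum_nonneg fun i hi => div_nonneg (hb i hi) (by linarith [hx i hi])
    have hL : (0 : ℝ) ≤ L + 1 := by positivity
    calc _ ≤ κ / R * (2 * (L + 1) * ∑ i ∈ P, b i / (1 + x i)) := by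
          gcongr
          exact sum_abs_mul_inv_one_add_abs_add_le hs hb hx hL
      _ = 2 * κ * (L + 1) / R * ∑ i ∈ P, b i / (1 + x i) := by ring
      _ ≤ _ := by gcongr; exact le_max_right _ _

end Shift

section PrimeWeight

open Finset Filter Topology ArithmeticFunction
open scoped NNReal

/-- The weight `Λ(n) / (n ^ (1 + σ) (1 + log n))`, which on primes is close to `1 / p` for `σ`
small. -/
noncomputable def primeWeight (σ : ℝ) (n : ℕ) : ℝ := mangoldtWeight σ n / (1 + Real.log n)

lemma primeWeight_nonneg (σ : ℝ) (n : ℕ) : 0 ≤ primeWeight σ n := by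
  have := Real.log_natCast_nonneg n
  exact div_nonneg (mangoldtWeight_nonneg σ n) (by positivity)

lemma natCast_mul_primeWeight_le_one {σ : ℝ} (hσ : 0 ≤ σ) {p : ℕ} (hp : p.Prime) :
    p * primeWeight σ p ≤ 1 := by
  have := Real.log_natCast_nonneg p
  have hp0 : (0 : ℝ) < p := by exact_mod_cast hp.pos
  have hle := mangoldtWeight_le hσ p
  rw [vonMangoldt_apply_prime hp, le_div_iff₀' hp0] at hle
  rw [primeWeight, ← mul_div_assoc, div_le_one (by positivity)]
  linarith

lemma exists_sum_mangoldtWeight_div_sq_le {ε : ℝ} (hε : 0 < ε) :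
    ∃ K : ℝ, ∀ σ : ℝ, 0 ≤ σ → ∀ P : Finset ℕ,
      ∑ n ∈ P, mangoldtWeight σ n / (1 + Real.log n) ^ 2 ≤ K + ε * ∑ n ∈ P, primeWeight σ n := by
  set T := ⌈Real.exp ε⁻¹⌉₊
  refine ⟨∑ n ∈ range T, vonMangoldt n / n, fun σ hσ P => ?_⟩
  have hterm (n : ℕ) : mangoldtWeight σ n / (1 + Real.log n) ^ 2 ≤
      (if n ∈ range T then vonMangoldt n / n else 0) + ε * primeWeight σ n := by
    have hlog := Real.log_natCast_nonneg n
    have hw := primeWeight_nonneg σ n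
    have hmw := mangoldtWeight_nonneg σ n
    split_ifs with hn
    · have : mangoldtWeight σ n / (1 + Real.log n) ^ 2 ≤ mangoldtWeight σ n :=
        div_le_self hmw (by nlinarith)
      nlinarith [mangoldtWeight_le hσ n]
    · have hexp : Real.exp ε⁻¹ ≤ n := Nat.ceil_le.1 (not_lt.1 (mem_range.not.1 hn))
      have hlog' : (1 + Real.log n)⁻¹ ≤ ε := by
        rw [inv_le_comm₀ (by positivity) hε]
        have := (Real.le_log_iff_exp_le ((Real.exp_pos _).trans_le hexp)).2 hexp
        linarith
      calc _ = (1 + Real.log n)⁻¹ * primeWeight σ n := by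
            rw [primeWeight, inv_mul_eq_div, div_div, sq]
        _ ≤ ε * primeWeight σ n := by gcongr
        _ = _ := (zero_add _).symm
  calc _ ≤ ∑ n ∈ P, ((if n ∈ range T then vonMangoldt n / n else 0) + ε * primeWeight σ n) :=
        sum_le_sum fun n _ => hterm n
    _ = ∑ n ∈ P with n ∈ range T, vonMangoldt n / n + ε * ∑ n ∈ P, primeWeight σ n := by
        rw [sum_add_distrib, ← mul_sum, sum_filter]
    _ ≤ _ := by
        gcongr
        exact fun n hn => (mem_filter.1 hn).2

lemma tendsto_sum_one_div_primes_atTop :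
    Tendsto (fun X : ℕ => ∑ p ∈ range X with p.Prime, (1 : ℝ) / p) atTop atTop := by
  have hdiv := not_summable_one_div_on_primes
  rw [not_summable_iff_tendsto_nat_atTop_of_nonneg
    (Set.indicator_nonneg fun _ _ => by positivity)] at hdiv
  simpa only [sum_filter, Set.indicator_apply, Set.mem_ofPred_eq] using hdiv

lemma one_div_le_three_mul_primeWeight_zero {p : ℕ} (hp : p.Prime) :
    (1 : ℝ) / p ≤ 3 * primeWeight 0 p := by
  have hlog : Real.log 2 ≤ Real.log p := Real.log_le_log two_pos (by exact_mod_cast hp.two_le)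
  have hlog2 := Real.log_two_gt_d9
  rw [primeWeight, mangoldtWeight, vonMangoldt_apply_prime hp, add_zero, Real.rpow_neg_one,
    ← mul_div_assoc, le_div_iff₀ (by linarith), one_div, mul_comm (Real.log _), mul_left_comm]
  gcongr
  linarith

lemma exists_eventually_le_sum_primeWeight (B : ℝ) :
    ∃ σ ∈ Set.Ioc (0 : ℝ) 1, ∀ᶠ X : ℕ in atTop,
      B ≤ ∑ p ∈ range X with p.Prime, primeWeight σ p := by
  obtain ⟨X₀, hX₀⟩ :=
    (tendsto_sum_one_div_primes_atTop.eventually_ge_atTop (3 * (B + 1))).exists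
  have hzero : B + 1 ≤ ∑ p ∈ range X₀ with p.Prime, primeWeight 0 p := by
    have : ∑ p ∈ range X₀ with p.Prime, (1 : ℝ) / p ≤
        3 * ∑ p ∈ range X₀ with p.Prime, primeWeight 0 p := by
      rw [mul_sum]
      exact sum_le_sum fun p hp => one_div_le_three_mul_primeWeight_zero (mem_filter.1 hp).2
    linarith
  have hcont : ContinuousAt (fun σ : ℝ => ∑ p ∈ range X₀ with p.Prime, primeWeight σ p) 0 := by
    refine tendsto_finsetSum _ fun p hp => Tendsto.div_const (Tendsto.const_mul _ ?_) _
    have hp0 : (p : ℝ) ≠ 0 := by exact_mod_cast (mem_filter.1 hp).2.ne_zero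
    exact (by fun_prop (disch := exact hp0) : ContinuousAt (fun σ : ℝ => (p : ℝ) ^ (-(1 + σ))) 0)
  have hev : ∀ᶠ σ : ℝ in 𝓝[>] 0, B ≤ ∑ p ∈ range X₀ with p.Prime, primeWeight σ p :=
    (hcont.tendsto.mono_left nhdsWithin_le_nhds).eventually_const_le (by linarith)
  obtain ⟨σ, hB, hσ⟩ := (hev.and (Ioc_mem_nhdsGT zero_lt_one)).exists
  refine ⟨σ, hσ, ?_⟩
  filter_upwards [eventually_ge_atTop X₀] with X hX
  exact hB.trans <| sum_le_sum_of_subset_of_nonneg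
    (filter_subset_filter _ (range_subset_range.2 hX)) fun p _ _ => primeWeight_nonneg σ p

theorem exists_primes_norm_sum_smul_sub_shift_le (E : Type*) [NormedAddCommGroup E]
    [NormedSpace ℝ E] [CompleteSpace E] {s : ℝ} (hs : 0 ≤ s) (L : ℝ≥0) {ε : ℝ} (hε : 0 < ε)
    (B : ℝ) :
    ∃ (P : Finset ℕ) (b : ℕ → ℝ), (∀ p ∈ P, p.Prime) ∧ (∀ p, 0 ≤ b p) ∧ (∀ p ∈ P, p * b p ≤ 1) ∧
      B ≤ ∑ p ∈ P, b p ∧ ∀ g : ℝ → E, (∀ u, ‖g u‖ ≤ 1) → LipschitzWith L g →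
        ‖∑ p ∈ P, b p • (g (Real.log p) - g (Real.log p + s))‖ ≤ ε * ∑ p ∈ P, b p := by
  obtain ⟨C, hC0, hC⟩ := exists_norm_sum_div_one_add_smul_shift_le E ℕ
  set R := 3 * C * (L + 1) / ε + 1 with hR
  obtain ⟨M, hM⟩ := exists_eventually_norm_one_sub_exp_mul_expSum_prime_le R s
  obtain ⟨K, hK⟩ := exists_sum_mangoldtWeight_div_sq_le (ε := ε / (3 * (s + 1))) (by positivity)
  obtain ⟨σ, hσ, hlarge⟩ :=
    exists_eventually_le_sum_primeWeight (max B (3 * (C * √R * M + s * K) / ε))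
  obtain ⟨X, hX, hXM⟩ := (hlarge.and (hM σ hσ)).exists
  have hprime (p : ℕ) (hp : p ∈ ({p ∈ range X | p.Prime} : Finset ℕ)) : p.Prime :=
    (mem_filter.1 hp).2
  refine ⟨{p ∈ range X | p.Prime}, primeWeight σ, hprime, primeWeight_nonneg σ,
    fun p hp => natCast_mul_primeWeight_le_one hσ.1.le (hprime p hp), (le_max_left _ _).trans hX,
    fun g hg1 hg => (hC _ (mangoldtWeight σ) (fun p => Real.log p) s R M
      (fun p _ => mangoldtWeight_nonneg σ p) (fun p _ => Real.log_natCast_nonneg p) hs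
      (by positivity) hXM g L hg1 hg).trans ?_⟩
  set W := ∑ p ∈ range X with p.Prime, primeWeight σ p
  have hW : 0 ≤ W := sum_nonneg fun p _ => primeWeight_nonneg σ p
  have hconst : C * √R * M + s * K ≤ ε / 3 * W := by
    have := (le_max_right _ _).trans hX
    rw [div_le_iff₀ hε] at this
    linarith
  have hlipschitz : C * (L + 1) / R * W ≤ ε / 3 * W := by
    refine mul_le_mul_of_nonneg_right ?_ hW
    rw [div_le_iff₀ (by positivity), hR]
    field_simp
    linarith
  have hshift : s * ∑ p ∈ range X with p.Prime, mangoldtWeight σ p / (1 + Real.log p) ^ 2 ≤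
      s * K + ε / 3 * W := by
    have hs1 : s * (ε / (3 * (s + 1))) ≤ ε / 3 := by
      field_simp
      linarith
    nlinarith [mul_le_mul_of_nonneg_left (hK σ hσ.1.le {p ∈ range X | p.Prime}) hs,
      mul_le_mul_of_nonneg_right hs1 hW]
  exact (add_le_add_left (add_le_add_right hlipschitz _) _).trans (by linarith)

end PrimeWeight

section SlowVariation

open Finset Filter Topology ArithmeticFunction

variable {E : Type*} [NormedAddCommGroup E] [NormedSpace ℝ E] [CompleteSpace E] {a a' : ℕ → E}

lemma eventually_two_mul_sqrt_add_one_le {ε : ℝ} (hε : 0 < ε) :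
    ∀ᶠ S : ℝ in atTop, 2 * (√S + 1) ≤ ε * S := by
  filter_upwards [Real.tendsto_sqrt_atTop.eventually_ge_atTop (max 1 (4 / ε)),
    eventually_ge_atTop 0] with S hS hS0
  have hone : 1 ≤ √S := (le_max_left _ _).trans hS
  have hsqrt : 4 / ε ≤ √S := (le_max_right _ _).trans hS
  rw [div_le_iff₀ hε] at hsqrt
  nlinarith [Real.mul_self_sqrt hS0]

lemma eventually_norm_sum_smul_interpolatedMean_sub_le_of_prime_mul {P : Finset ℕ} {b : ℕ → ℝ}
    (hP : ∀ p ∈ P, p.Prime) (hb0 : ∀ p ∈ P, 0 ≤ b p) (hb1 : ∀ p ∈ P, p * b p ≤ 1)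
    (ha : ∀ n, ‖a n‖ ≤ 1) (ha' : ∀ n, ‖a' n‖ ≤ 1)
    (haa' : ∀ p, p.Prime → ∀ m, 0 < m → a (p * m) = a' m) :
    ∀ᶠ y : ℝ in atTop,
      ‖(∑ p ∈ P, b p) • interpolatedMean a y - ∑ p ∈ P, b p • interpolatedMean a' (y / p)‖ ≤
        √(∑ p ∈ P, b p) + 1 :=
  eventually_norm_sum_smul_interpolatedMean_sub_le
    (fun p hp q hq => (Nat.coprime_primes (hP p hp) (hP q hq)).2) (fun p hp => (hP p hp).pos)
    hb0 hb1 ha ha' fun p hp => haa' p (hP p hp)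

theorem tendsto_interpolatedMean_sub_div (ha : ∀ n, ‖a n‖ ≤ 1)
    (ha' : ∀ n, ‖a' n‖ ≤ 1) (haa' : ∀ p, p.Prime → ∀ m, 0 < m → a (p * m) = a' m) {l : ℝ}
    (hl : 1 ≤ l) :
    Tendsto (fun y => interpolatedMean a y - interpolatedMean a (y / l)) atTop (𝓝 0) := by
  have hl0 : 0 < l := by positivity
  rw [NormedAddGroup.tendsto_nhds_zero]
  intro ε hε
  obtain ⟨B, hB⟩ :=
    eventually_atTop.1 (eventually_two_mul_sqrt_add_one_le (by positivity : 0 < ε / 3))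
  obtain ⟨P, b, hP, hb0, hb1, hPB, hg⟩ := exists_primes_norm_sum_smul_sub_shift_le E
    (Real.log_nonneg hl) (2 * 1) (by positivity : 0 < ε / 3) (max 1 B)
  have hdilate := eventually_norm_sum_smul_interpolatedMean_sub_le_of_prime_mul hP
    (fun p _ => hb0 p) hb1 ha ha' haa'
  set S := ∑ p ∈ P, b p
  have hS : 0 < S := one_pos.trans_le ((le_max_left _ _).trans hPB)
  have hsqrt := hB S ((le_max_right _ _).trans hPB)
  filter_upwards [hdilate, (tendsto_id.atTop_div_const hl0).eventually hdilate,
    eventually_gt_atTop 0] with y h1 h2 hy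
  have hshift : ‖∑ p ∈ P, b p • interpolatedMean a' (y / p)
      - ∑ p ∈ P, b p • interpolatedMean a' (y / l / p)‖ ≤ ε / 3 * S := by
    refine le_of_eq_of_le ?_ (hg (fun u => interpolatedMean a' (y * Real.exp (-u)))
      (fun u => norm_interpolatedMean_le ha' _) (lipschitzWith_interpolatedMean_mul_exp_neg ha' hy))
    rw [← sum_sub_distrib]
    refine congrArg norm (sum_congr rfl fun p hp => ?_)
    have hp0 : (0 : ℝ) < p := by exact_mod_cast (hP p hp).pos
    rw [neg_add, Real.exp_add, Real.exp_neg, Real.exp_neg, Real.exp_log hp0, Real.exp_log hl0,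
      smul_sub, ← mul_assoc, ← div_eq_mul_inv, ← div_eq_mul_inv, div_right_comm]
  have htotal : S * ‖interpolatedMean a y - interpolatedMean a (y / l)‖ ≤
      (√S + 1) + (√S + 1) + ε / 3 * S := by
    rw [← Real.norm_of_nonneg hS.le, ← norm_smul, Real.norm_of_nonneg hS.le]
    refine le_of_eq_of_le ?_ (norm_add_le_of_le (norm_sub_le_of_le h1 h2) hshift)
    rw [id, smul_sub]
    congr 1
    abel
  nlinarith

theorem tendsto_interpolatedMean_sub_of_prime_mul (ha : ∀ n, ‖a n‖ ≤ 1) (ha' : ∀ n, ‖a' n‖ ≤ 1)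
    (haa' : ∀ p, p.Prime → ∀ m, 0 < m → a (p * m) = a' m)
    (hslow : ∀ p : ℕ, p.Prime →
      Tendsto (fun y => interpolatedMean a' y - interpolatedMean a' (y / p)) atTop (𝓝 0)) :
    Tendsto (fun y => interpolatedMean a' y - interpolatedMean a y) atTop (𝓝 0) := by
  rw [NormedAddGroup.tendsto_nhds_zero]
  intro ε hε
  obtain ⟨X, hsqrt, hS⟩ := ((tendsto_sum_one_div_primes_atTop.eventually
    (eventually_two_mul_sqrt_add_one_le hε)).and
      (tendsto_sum_one_div_primes_atTop.eventually_gt_atTop 0)).exists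
  set P : Finset ℕ := {p ∈ range X | p.Prime}
  set S := ∑ p ∈ P, (1 : ℝ) / p
  have hP (p : ℕ) (hp : p ∈ P) : p.Prime := (mem_filter.1 hp).2
  have hdilate := eventually_norm_sum_smul_interpolatedMean_sub_le_of_prime_mul
    (b := fun p => 1 / p) hP (fun p _ => by positivity)
    (fun p hp => (mul_one_div_cancel (Nat.cast_ne_zero.2 (hP p hp).ne_zero)).le)
    ha ha' haa'
  have hlim : Tendsto (fun y => ∑ p ∈ P, ((1 : ℝ) / p) •
      (interpolatedMean a' y - interpolatedMean a' (y / p))) atTop (𝓝 0) := by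
    simpa using tendsto_finsetSum P fun p hp => (hslow p (hP p hp)).const_smul ((1 : ℝ) / p)
  filter_upwards [hdilate, NormedAddGroup.tendsto_nhds_zero.1 hlim 1 one_pos] with y h1 h2
  have htotal : S * ‖interpolatedMean a' y - interpolatedMean a y‖ < 1 + (√S + 1) := by
    rw [← Real.norm_of_nonneg hS.le, ← norm_smul, Real.norm_of_nonneg hS.le]
    refine lt_of_eq_of_lt ?_ ((norm_sub_le _ _).trans_lt (add_lt_add_of_lt_of_le h2 h1))
    simp_rw [smul_sub, sum_sub_distrib, ← sum_smul]
    congr 1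
    abel
  nlinarith [Real.sqrt_nonneg S]

lemma cardFactors_prime_mul {p m : ℕ} (hp : p.Prime) (hm : 0 < m) :
    cardFactors (p * m) = cardFactors m + 1 := by
  rw [cardFactors_mul hp.ne_zero hm.ne', cardFactors_apply_prime hp, add_comm]

lemma tendsto_interpolatedMean_cardFactors_add_one_sub {f : ℕ → E} (hf : ∀ k, ‖f k‖ ≤ 1) :
    Tendsto (fun y => interpolatedMean (fun n => f (cardFactors n + 1)) y
      - interpolatedMean (fun n => f (cardFactors n)) y) atTop (𝓝 0) :=
  tendsto_interpolatedMean_sub_of_prime_mul (a := fun n => f (cardFactors n))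
    (fun n => hf (cardFactors n)) (fun n => hf (cardFactors n + 1))
    (fun p hp m hm => congrArg f (cardFactors_prime_mul hp hm)) fun p hp =>
      tendsto_interpolatedMean_sub_div (a' := fun n => f (cardFactors n + 1 + 1))
        (fun n => hf (cardFactors n + 1)) (fun n => hf (cardFactors n + 1 + 1))
        (fun q hq m hm => congrArg (fun k => f (k + 1)) (cardFactors_prime_mul hq hm))
        (by exact_mod_cast hp.one_le)

theorem tendsto_cesaroMean_cardFactors_add_one_sub {f : ℕ → E} {C : ℝ} (hf : ∀ k, ‖f k‖ ≤ C) :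
    Tendsto (fun N => cesaroMean (fun n => f (cardFactors n + 1)) N
      - cesaroMean (fun n => f (cardFactors n)) N) atTop (𝓝 0) := by
  set D := max 1 C
  have hD : 0 < D := lt_max_of_lt_left one_pos
  have hunit (k : ℕ) : ‖D⁻¹ • f k‖ ≤ 1 := by
    rw [norm_smul, norm_inv, Real.norm_of_nonneg hD.le, inv_mul_le_one₀ hD]
    exact (hf k).trans (le_max_right _ _)
  have hlim := ((tendsto_interpolatedMean_cardFactors_add_one_sub hunit).comp
    tendsto_natCast_atTop_atTop).const_smul D
  simpa [Function.comp_def, interpolatedMean_natCast, cesaroMean_const_smul, smul_sub,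
    smul_inv_smul₀ hD.ne'] using hlim

end SlowVariation

section Equidistribution

open Finset Filter Topology MeasureTheory

lemma hasNaturalDensity_iff_tendsto_cesaroMean {A : Set ℕ} {d : ℝ} :
    HasNaturalDensity A d ↔ Tendsto (cesaroMean (A.indicator (1 : ℕ → ℝ))) atTop (𝓝 d) := by
  classical
  refine tendsto_congr fun N => ?_
  simp only [cesaroMean, Set.indicator_apply, Pi.one_apply, sum_boole, smul_eq_mul,
    div_eq_inv_mul]

lemma cesaroMean_indicator_compl (A : Set ℕ) {N : ℕ} (hN : N ≠ 0) :
    cesaroMean (Aᶜ.indicator (1 : ℕ → ℝ)) N = 1 - cesaroMean (A.indicator 1) N := by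
  rw [Set.indicator_compl, ← cesaroMean_const (1 : ℝ) hN]
  exact cesaroMean_sub _ _ N

variable {X : Type*} [TopologicalSpace X] [MeasurableSpace X]

/-- The sequence `x 1, x 2, …` in a compact space is equidistributed with respect to `μ`. -/
def IsEquidistributed (x : ℕ → X) (μ : Measure X) : Prop :=
  ∀ F : C(X, ℝ), Tendsto (cesaroMean fun n => F (x n)) atTop (𝓝 (∫ z, F z ∂μ))

lemma isClosed_setOf_tendsto_cesaroMean_comp [BorelSpace X] [CompactSpace X] {E : Type*}
    [NormedAddCommGroup E] [NormedSpace ℝ E] [SecondCountableTopologyEither X E] (x : ℕ → X)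
    (μ : Measure X) [IsFiniteMeasure μ] :
    IsClosed {F : C(X, E) | Tendsto (cesaroMean fun n => F (x n)) atTop (𝓝 (∫ z, F z ∂μ))} := by
  have hlip (N : ℕ) : LipschitzWith 1 fun F : C(X, E) => cesaroMean (fun n => F (x n)) N := by
    refine LipschitzWith.mk_one fun F G => ?_
    rw [dist_eq_norm, ← cesaroMean_sub]
    exact norm_cesaroMean_le
      (fun n => (dist_eq_norm (F (x n)) (G (x n))).symm.trans_le (F.dist_apply_le_dist (x n))) N
  have hcont : Continuous fun F : C(X, E) => ∫ z, F z ∂μ :=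
    (continuous_integral.comp (ContinuousMap.toLp 1 μ ℝ).continuous).congr fun F =>
      integral_congr_ae (ContinuousMap.coeFn_toLp μ F)
  exact (LipschitzWith.uniformEquicontinuous _ 1 hlip).equicontinuous.isClosed_setOfPred_tendsto
    hcont

variable [OpensMeasurableSpace X] {μ : Measure X} [IsFiniteMeasure μ]

lemma exists_continuousMap_integral_lt [HasOuterApproxClosed X] {K : Set X} (hK : IsClosed K)
    {c : ℝ} (hc : μ.real K < c) :
    ∃ F : C(X, ℝ), (∀ z, 0 ≤ F z) ∧ (∀ z ∈ K, F z = 1) ∧ ∫ z, F z ∂μ < c := by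
  have hμK : μ K < ENNReal.ofReal c :=
    (ENNReal.lt_ofReal_iff_toReal_lt (measure_ne_top μ K)).2 hc
  obtain ⟨n, hn⟩ :=
    ((HasOuterApproxClosed.tendsto_lintegral_apprSeq hK μ).eventually_lt_const hμK).exists
  refine ⟨⟨fun z => hK.apprSeq n z, by fun_prop⟩, fun z => NNReal.coe_nonneg _,
    fun z hz => by simp [HasOuterApproxClosed.apprSeq_apply_eq_one hK n hz], ?_⟩
  have hlt := (ENNReal.lt_ofReal_iff_toReal_lt hn.ne_top).1 hn
  rwa [BoundedContinuousFunction.toReal_lintegral_coe_eq_integral] at hlt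

variable {x : ℕ → X}

lemma IsEquidistributed.eventually_cesaroMean_indicator_lt [HasOuterApproxClosed X]
    (hx : IsEquidistributed x μ) {K : Set X} (hK : IsClosed K) {A : Set ℕ}
    (hA : ∀ n ∈ A, x n ∈ K) {c : ℝ} (hc : μ.real K < c) :
    ∀ᶠ N in atTop, cesaroMean (A.indicator 1) N < c := by
  obtain ⟨F, hF0, hF1, hFc⟩ := exists_continuousMap_integral_lt hK hc
  filter_upwards [(hx F).eventually_lt_const hFc] with N hN
  exact (cesaroMean_mono
    (Set.indicator_le' (fun n hn => (hF1 _ (hA n hn)).ge) fun n _ => hF0 _) N).trans_lt hN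

theorem IsEquidistributed.hasNaturalDensity [HasOuterApproxClosed X]
    (hx : IsEquidistributed x μ) {K L : Set X} (hK : IsClosed K) (hL : IsClosed L)
    (hKL : μ.real K + μ.real L ≤ 1) {A : Set ℕ} (hA : ∀ n ∈ A, x n ∈ K)
    (hAc : ∀ n ∈ Aᶜ, x n ∈ L) : HasNaturalDensity A (μ.real K) := by
  refine hasNaturalDensity_iff_tendsto_cesaroMean.2 (tendsto_order.2 ⟨fun c hc => ?_, fun c hc =>
    hx.eventually_cesaroMean_indicator_lt hK hA hc⟩)
  filter_upwards [hx.eventually_cesaroMean_indicator_lt hL hAc (c := 1 - c) (by linarith),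
    eventually_ne_atTop 0] with N hN hN0
  rw [cesaroMean_indicator_compl A hN0] at hN
  linarith

end Equidistribution

section Weyl

open Finset Filter Topology MeasureTheory

lemma coe_mem_closedBall_of_mem_Icc {T c d t : ℝ} (ht : t ∈ Set.Icc c d) :
    (t : AddCircle T) ∈ Metric.closedBall (((c + d) / 2 : ℝ) : AddCircle T) ((d - c) / 2) := by
  rw [mem_closedBall_iff_norm, ← AddCircle.coe_sub]
  refine (QuotientAddGroup.norm_mk_le_norm).trans (abs_le.2 ⟨?_, ?_⟩) <;> linarith [ht.1, ht.2]

variable {T : ℝ} [hT : Fact (0 < T)]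

theorem tendsto_cesaroMean_comp_of_fourier {x : ℕ → AddCircle T}
    (hx : ∀ k : ℤ, k ≠ 0 → Tendsto (cesaroMean fun n => fourier k (x n)) atTop (𝓝 0))
    (F : C(AddCircle T, ℂ)) :
    Tendsto (cesaroMean fun n => F (x n)) atTop (𝓝 (∫ z, F z ∂AddCircle.haarAddCircle)) := by
  have hint (G : C(AddCircle T, ℂ)) : Integrable G AddCircle.haarAddCircle :=
    G.continuous.integrable_of_hasCompactSupport (HasCompactSupport.of_compactSpace _)
  have hF : F ∈ (Submodule.span ℂ (Set.range (fourier (T := T)))).topologicalClosure := by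
    rw [span_fourier_closure_eq_top]
    trivial
  refine closure_minimal (fun G hG => ?_)
    (isClosed_setOf_tendsto_cesaroMean_comp x AddCircle.haarAddCircle) hF
  induction hG using Submodule.span_induction with
  | mem G hG =>
    obtain ⟨k, rfl⟩ := hG
    by_cases hk : k = 0
    · subst hk
      refine tendsto_const_nhds.congr' ?_
      filter_upwards [eventually_ne_atTop 0] with N hN
      simp [cesaroMean_const _ hN]
    · have := integral_eq_zero_of_add_right_eq_neg (μ := AddCircle.haarAddCircle)
        (fourier_add_half_inv_index hk hT.out)
      simpa only [Set.mem_ofPred_eq, this] using hx k hk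
  | zero =>
    have hzero (N : ℕ) : (0 : ℂ) = cesaroMean (fun _ => 0) N := by simp [cesaroMean]
    simpa using tendsto_const_nhds.congr hzero
  | add G H _ _ hG hH =>
    simp only [Set.mem_ofPred_eq, ContinuousMap.add_apply, integral_add (hint G) (hint H)]
    exact (hG.add hH).congr fun N => (cesaroMean_add _ _ N).symm
  | smul c G _ hG =>
    simp only [Set.mem_ofPred_eq, ContinuousMap.smul_apply, integral_smul]
    exact (hG.const_smul c).congr fun N => (cesaroMean_const_smul c _ N).symm

theorem isEquidistributed_haarAddCircle_of_fourier {x : ℕ → AddCircle T}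
    (hx : ∀ k : ℤ, k ≠ 0 → Tendsto (cesaroMean fun n => fourier k (x n)) atTop (𝓝 0)) :
    IsEquidistributed x AddCircle.haarAddCircle := by
  intro F
  have hlim := (Complex.continuous_re.tendsto _).comp
    (tendsto_cesaroMean_comp_of_fourier hx ⟨fun z => (F z : ℂ), by fun_prop⟩)
  simp only [ContinuousMap.coe_mk, integral_complex_ofReal, Complex.ofReal_re] at hlim
  exact hlim.congr fun N => map_cesaroMean Complex.reLm _ N

lemma measureReal_haarAddCircle_closedBall (z : UnitAddCircle) {c d : ℝ} (hcd : c ≤ d)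
    (hd : d ≤ c + 1) :
    AddCircle.haarAddCircle.real (Metric.closedBall z ((d - c) / 2)) = d - c := by
  have hvol : (volume : Measure UnitAddCircle) = AddCircle.haarAddCircle := by
    rw [AddCircle.volume_eq_smul_haarAddCircle, ENNReal.ofReal_one, one_smul]
  rw [← hvol, Measure.real, AddCircle.volume_closedBall, mul_div_cancel₀ _ two_ne_zero,
    min_eq_right (by linarith), ENNReal.toReal_ofReal (by linarith)]

theorem uniformlyDistributedModOne_of_fourier {x : ℕ → ℝ}
    (hx : ∀ k : ℤ, k ≠ 0 →
      Tendsto (cesaroMean fun n => fourier k (x n : UnitAddCircle)) atTop (𝓝 0)) :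
    UniformlyDistributedModOne x := by
  intro a b ha hab hb
  rw [← measureReal_haarAddCircle_closedBall (((a + b) / 2 : ℝ) : UnitAddCircle) hab.le
    (by linarith)]
  refine (isEquidistributed_haarAddCircle_of_fourier hx).hasNaturalDensity
    Metric.isClosed_closedBall (L := Metric.closedBall (((b + (a + 1)) / 2 : ℝ) : UnitAddCircle)
      ((a + 1 - b) / 2)) Metric.isClosed_closedBall ?_ (fun n hn => ?_) fun n hn => ?_
  · rw [measureReal_haarAddCircle_closedBall _ hab.le (by linarith),
      measureReal_haarAddCircle_closedBall _ (by linarith) (by linarith)]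
    linarith
  · rw [← AddCircle.coe_fract (x n)]
    exact coe_mem_closedBall_of_mem_Icc (Set.Ico_subset_Icc_self hn)
  · have hfract := Int.fract_lt_one (x n)
    have hfract0 := Int.fract_nonneg (x n)
    rw [← AddCircle.coe_fract (x n)]
    rcases lt_or_ge (Int.fract (x n)) a with hlt | hge
    · have hmem := coe_mem_closedBall_of_mem_Icc (T := 1) (c := b) (d := a + 1)
        (t := Int.fract (x n) + 1) ⟨by linarith, by linarith⟩
      rwa [AddCircle.coe_add_period] at hmem
    · refine coe_mem_closedBall_of_mem_Icc ⟨?_, by linarith⟩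
      by_contra! hlt
      exact hn ⟨hge, hlt⟩

end Weyl

section CardFactors

open Finset Filter Topology ArithmeticFunction

lemma sum_range_add_of_periodic {M : Type*} [AddCancelCommMonoid M] {f : ℕ → M} {m : ℕ}
    (hf : Function.Periodic f m) (k : ℕ) :
    ∑ j ∈ range m, f (k + j) = ∑ j ∈ range m, f j := by
  induction k with
  | zero => simp
  | succ k ih =>
    rw [← ih, ← add_left_inj (f k)]
    calc ∑ j ∈ range m, f (k + 1 + j) + f k = ∑ j ∈ range (m + 1), f (k + j) := by
          simp [sum_range_succ', add_assoc, add_comm 1]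
      _ = ∑ j ∈ range m, f (k + j) + f k := by rw [sum_range_succ, hf]

variable {E : Type*} [NormedAddCommGroup E] [NormedSpace ℝ E]

theorem tendsto_cesaroMean_pow_cardFactors {𝕜 : Type*} [RCLike 𝕜] {z : 𝕜} (hz : ‖z‖ ≤ 1)
    (hz1 : z ≠ 1) : Tendsto (cesaroMean fun n => z ^ cardFactors n) atTop (𝓝 0) := by
  have hpow (k : ℕ) : ‖z ^ k‖ ≤ 1 := by
    rw [norm_pow]
    exact pow_le_one₀ (norm_nonneg z) hz
  have hlim := (tendsto_cesaroMean_cardFactors_add_one_sub hpow).const_smul (z - 1)⁻¹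
  rw [smul_zero] at hlim
  refine hlim.congr fun N => ?_
  have hsucc := cesaroMean_const_smul z (fun n => z ^ cardFactors n) N
  simp only [smul_eq_mul, ← pow_succ'] at hsucc
  rw [hsucc, ← sub_one_mul, smul_eq_mul, inv_mul_cancel_left₀ (sub_ne_zero.2 hz1)]

theorem tendsto_cesaroMean_liouville :
    Tendsto (cesaroMean fun n => (liouville n : ℝ)) atTop (𝓝 0) := by
  refine (tendsto_cesaroMean_pow_cardFactors (z := (-1 : ℝ)) (by simp) (by norm_num)).congr
    (cesaroMean_congr fun n hn => ?_)
  rw [liouville_apply hn.ne']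
  push_cast
  rfl

variable [CompleteSpace E] {f : ℕ → E}

theorem tendsto_cesaroMean_cardFactors_add_sub {C : ℝ} (hf : ∀ k, ‖f k‖ ≤ C) (j : ℕ) :
    Tendsto (fun N => cesaroMean (fun n => f (cardFactors n + j)) N
      - cesaroMean (fun n => f (cardFactors n)) N) atTop (𝓝 0) := by
  induction j with
  | zero => simp
  | succ j ih =>
    have hstep := tendsto_cesaroMean_cardFactors_add_one_sub (f := fun k => f (k + j))
      fun k => hf (k + j)
    simpa [add_right_comm, add_assoc] using hstep.add ih

theorem tendsto_cesaroMean_cardFactors_of_periodic {m : ℕ} (hm : m ≠ 0)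
    (hf : Function.Periodic f m) :
    Tendsto (cesaroMean fun n => f (cardFactors n)) atTop
      (𝓝 ((m : ℝ)⁻¹ • ∑ j ∈ range m, f j)) := by
  have hm0 : (m : ℝ) ≠ 0 := Nat.cast_ne_zero.2 hm
  have hbound (k : ℕ) : ‖f k‖ ≤ ∑ j ∈ range m, ‖f j‖ := by
    rw [← hf.map_mod_nat k]
    exact single_le_sum (f := fun j => ‖f j‖) (fun _ _ => norm_nonneg _)
      (mem_range.2 (k.mod_lt (Nat.pos_of_ne_zero hm)))
  have hlim := (tendsto_finsetSum (range m) fun j _ =>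
    tendsto_cesaroMean_cardFactors_add_sub hbound j).const_smul (m : ℝ)⁻¹
  rw [sum_const_zero, smul_zero] at hlim
  refine (sub_zero ((m : ℝ)⁻¹ • ∑ j ∈ range m, f j) ▸ hlim.const_sub _).congr' ?_
  filter_upwards [eventually_ne_atTop 0] with N hN
  have hsum : ∑ j ∈ range m, cesaroMean (fun n => f (cardFactors n + j)) N =
      ∑ j ∈ range m, f j := by
    simp_rw [← cesaroMean_sum, sum_range_add_of_periodic hf, cesaroMean_const _ hN]
  rw [sum_sub_distrib, hsum, sum_const, card_range, smul_sub, ← Nat.cast_smul_eq_nsmul ℝ,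
    inv_smul_smul₀ hm0, sub_sub_cancel]

theorem hasNaturalDensity_cardFactors_modEq {m : ℕ} (hm : m ≠ 0) (r : ℕ) :
    HasNaturalDensity {n | cardFactors n ≡ r [MOD m]} (1 / m) := by
  set f : ℕ → ℝ := {k | k ≡ r [MOD m]}.indicator 1 with hf
  have hperiodic : Function.Periodic f m := fun k => by simp [hf, Set.indicator_apply]
  have hsum : ∑ j ∈ range m, f j = 1 := by
    have hnotMem (j : ℕ) (hj : j ∈ range m) (hne : j ≠ r % m) : f j = 0 :=
      Set.indicator_of_notMem
        (fun h : j % m = r % m => hne (Nat.mod_eq_of_lt (mem_range.1 hj) ▸ h)) 1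
    rw [sum_eq_single_of_mem (r % m) (mem_range.2 (r.mod_lt (Nat.pos_of_ne_zero hm))) hnotMem]
    exact Set.indicator_of_mem (s := {k | k ≡ r [MOD m]}) (Nat.mod_modEq r m) 1
  have hlim := tendsto_cesaroMean_cardFactors_of_periodic hm hperiodic
  rw [hsum, smul_eq_mul, mul_one, ← one_div] at hlim
  exact hasNaturalDensity_iff_tendsto_cesaroMean.2 hlim

theorem uniformlyDistributedModOne_cardFactors_mul {α : ℝ} (hα : Irrational α) :
    UniformlyDistributedModOne fun n => (cardFactors n : ℝ) * α := by
  refine uniformlyDistributedModOne_of_fourier fun k hk => ?_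
  have hpow (n : ℕ) : fourier k ((cardFactors n * α : ℝ) : UnitAddCircle) =
      (fourier k (α : UnitAddCircle)) ^ cardFactors n := by
    rw [← nsmul_eq_mul, AddCircle.coe_nsmul, fourier_apply, smul_comm, AddCircle.toCircle_nsmul,
      Circle.coe_pow, fourier_apply]
  simp_rw [hpow]
  refine tendsto_cesaroMean_pow_cardFactors (Circle.norm_coe _).le fun hone => ?_
  rw [fourier_apply, Circle.coe_eq_one, ← AddCircle.toCircle_zero,
    (AddCircle.injective_toCircle one_ne_zero).eq_iff, ← AddCircle.coe_zsmul,
    AddCircle.coe_eq_zero_iff] at hone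
  obtain ⟨j, hj⟩ := hone
  exact (hα.intCast_mul hk).ne_int j (by simpa using hj.symm)

end CardFactors

theorem theorem1_general (E : Type*) [NormedAddCommGroup E] [NormedSpace ℝ E] [CompleteSpace E] :
    (∀ f : ℕ → E, (∃ C : ℝ, ∀ k : ℕ, ‖f k‖ ≤ C) →
      Filter.Tendsto
        (fun N => cesaroMean (fun n => f (ArithmeticFunction.cardFactors n + 1)) N
          - cesaroMean (fun n => f (ArithmeticFunction.cardFactors n)) N)
        Filter.atTop (nhds 0)) ∧
    Filter.Tendsto (cesaroMean fun n => (ArithmeticFunction.liouville n : ℝ))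
      Filter.atTop (nhds 0) ∧
    (∀ z : ℂ, ‖z‖ ≤ 1 → z ≠ 1 →
      Filter.Tendsto (cesaroMean fun n => z ^ ArithmeticFunction.cardFactors n)
        Filter.atTop (nhds 0)) ∧
    (∀ m r : ℕ, m ≠ 0 →
      HasNaturalDensity {n | ArithmeticFunction.cardFactors n ≡ r [MOD m]} (1 / m)) ∧
    (∀ α : ℝ, Irrational α →
      UniformlyDistributedModOne fun n => (ArithmeticFunction.cardFactors n : ℝ) * α) :=
  ⟨fun _ ⟨_, hC⟩ => tendsto_cesaroMean_cardFactors_add_one_sub hC, tendsto_cesaroMean_liouville,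
    fun _ hz hz1 => tendsto_cesaroMean_pow_cardFactors hz hz1,
    fun _ r hm => hasNaturalDensity_cardFactors_modEq hm r,
    fun _ hα => uniformlyDistributedModOne_cardFactors_mul hα⟩

theorem theorem1 :
    -- the main result, for every bounded `f`
    (∀ f : ℕ → ℂ, (∃ C : ℝ, ∀ k : ℕ, ‖f k‖ ≤ C) →
      Filter.Tendsto
        (fun N : ℕ =>
          (1 / (N : ℂ)) * ∑ n ∈ Finset.Icc 1 N, f (ArithmeticFunction.cardFactors n + 1)
            - (1 / (N : ℂ)) * ∑ n ∈ Finset.Icc 1 N, f (ArithmeticFunction.cardFactors n))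
        Filter.atTop (nhds 0)) ∧
    -- the Liouville function has mean value zero
    Filter.Tendsto
      (fun N : ℕ =>
        (1 / (N : ℝ)) * ∑ n ∈ Finset.Icc 1 N, (ArithmeticFunction.liouville n : ℝ))
      Filter.atTop (nhds 0) ∧
    -- roots of unity
    (∀ (m : ℕ) (ζ : ℂ), 1 ≤ m → ζ ^ m = 1 → ζ ≠ 1 →
      Filter.Tendsto
        (fun N : ℕ =>
          (1 / (N : ℂ)) * ∑ n ∈ Finset.Icc 1 N, ζ ^ ArithmeticFunction.cardFactors n)
        Filter.atTop (nhds 0)) ∧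
    -- Pillai and Selberg
    (∀ m r : ℕ, 1 ≤ m → r < m →
      HasNaturalDensity {n : ℕ | ArithmeticFunction.cardFactors n ≡ r [MOD m]} (1 / (m : ℝ))) ∧
    -- Erdős and Delange
    (∀ α : ℝ, Irrational α →
      UniformlyDistributedModOne (fun n : ℕ => (ArithmeticFunction.cardFactors n : ℝ) * α)) := by
  simp_rw [← cesaroMean_eq_one_div_mul]
  obtain ⟨hshift, hliouville, hpow, hdensity, huniform⟩ := theorem1_general ℂ
  exact ⟨hshift, hliouville,
    fun m ζ hm hζ => hpow ζ (Complex.norm_eq_one_of_pow_eq_one hζ (by omega)).le,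
    fun m r hm _ => hdensity m r (by omega), huniform⟩
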